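/- **Setting.** Everything is $C^\infty$. Let $\mathfrak G$ be a Lie group of dimension $r$ with Lie algebra $\mathfrak g$, and let $\pi:\mathcal P\to\mathcal M$ be a principal $\mathfrak G$-bundle (right action $z\mapsto R_g(z)=z\cdot g$) over an $n$-manifold $\mathcal M$ with a pseudo-Riemannian metric, where $n+r\ge 2$. Let $\mathsf h$ be an $\mathrm{Ad}$-invariant metric (nondegenerate symmetric bilinear form) on $\mathfrak g$, $\mathsf h^*:\mathfrak g^*\to\mathfrak g$ the inverse of $\xi\mapsto\mathsf h(\xi,\cdot)$, $(t_1,\dots,t_r)$ a basis of $\mathfrak g$, $\rho_\xi(z)=\frac{d}{dt}|_{t=0}\,z\cdot e^{t\xi}$, $\rho_j=\rho_{t_j}$, and $\kappa=(\kappa_{ab})$ a fixed invertible symmetric real $n\times n$ matrix with inverse $(\kappa^{ab})$. A *local gauge* over an open $U\subset\mathcal M$ is a local section $\sigma$ of $\mathcal P$ together with a frame $(\underline e_1,\dots,\underline e_n)$ of $T\mathcal M|_U$ with $\langle\underline e_a,\underline e_b\rangle=\kappa_{ab}$. Let $\omega^c_b$ be the Levi-Civita connection forms in this frame, $\nabla_{\underline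 e_a}\underline e_b=\omega^c_b(\underline e_a)\underline e_c$, and also their pull-backs to $\mathcal P$. On $\pi^{-1}(U)$ put $e_a(\sigma(x)\cdot g)=d(R_g\circ\sigma)_x(\underline e_a(x))$; then $(e_1,\dots,e_n,\rho_1,\dots,\rho_r)$ is a frame of $T\mathcal P$, with dual coframe $(\beta^a,\gamma^j)$. Put $\beta=\beta^1\wedge\dots\wedge\beta^n$, $\gamma=\gamma^1\wedge\dots\wedge\gamma^r$, $\beta_a=e_a\lrcorner\beta$, $\beta_{ab}=e_b\lrcorner e_a\lrcorner\beta$, $\gamma_j=\rho_j\lrcorner\gamma$, $\gamma_{jk}=\rho_k\lrcorner\rho_j\lrcorner\gamma$. Fix a family of local gauges whose domains cover $\mathcal M$ and for which $\beta\wedge\gamma$ is one and the same volume form on $\mathcal P$. Let $\eta$ be a $\mathfrak g$-valued 1-form on $\mathcal P$ that is normalized, i.e. $\eta(\rho_\xi)=\xi$ for all $\xi\in\mathfrak g$ (equivariance is not assumed), and let $p$ be a $\mathfrak g^*$-valued $(n+r-2)$-form on $\mathcal P$. In a gauge write $\eta=\eta_a\beta^a+t_j\gamma^j$ and $$p=-\tfrac12p^{ab}\beta_{ab}\wedge\gamma+(-1)^np^{aj}\beta_a\wedge\gamma_j+\tfrac12p^{jk}\beta\wedge\gamma_{jk},\qquad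 p^{ab}=-p^{ba},\quad p^{jk}=-p^{kj},$$ and $p_{ab}=\kappa_{ac}\kappa_{bd}p^{cd}$, $\eta_{b;a}=(d\eta_b-\eta_c\omega^c_b)(e_a)$, $\eta_{a;j}=d\eta_a(\rho_j)$, $p^{ab}{}_{;c}=(dp^{ab}+p^{db}\omega^a_d+p^{ad}\omega^b_d)(e_c)$, $p^{aj}{}_{;k}=dp^{aj}(\rho_k)$, $\mathrm{ad}^*_\xi\ell=\ell\circ\mathrm{ad}_\xi$. The pair $(\eta,p)$ *solves the HVDW system* if in every gauge of the family, for all $a,b,j$ (with summation over repeated indices in the first and third lines), $$\begin{aligned}\eta_{b;a}-\eta_{a;b}+[\eta_a,\eta_b]&=\mathsf h^*p_{ab},\\ \eta_{a;j}+[t_j,\eta_a]&=0,\\ p^{ab}{}_{;b}-\mathrm{ad}^*_{\eta_b}p^{ab}+p^{aj}{}_{;j}-\mathrm{ad}^*_{t_j}p^{aj}-\mathrm{tr}(\mathrm{ad}_{t_j})\,p^{aj}&=0.\end{aligned}$$ **Theorem.** Assume that $\mathfrak g$ is unimodular ($\mathrm{tr}(\mathrm{ad}_\xi)=0$ for all $\xi\in\mathfrak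 g$) and that $\mathfrak G$ is compact. Then for every solution $(\eta,p)$ of the HVDW system: 1. $R_g^*\eta=\mathrm{Ad}_{g^{-1}}\circ\eta$ for every $g$ in the identity component of $\mathfrak G$; in particular, if $\mathfrak G$ is connected, $\eta$ is equivariant, that is, $R_g^*\eta=\mathrm{Ad}_{g^{-1}}\circ\eta$ for all $g\in\mathfrak G$. 2. $\eta$ solves the classical Yang–Mills equations: in every gauge of the family, the gauge potential $A=\sigma^*\eta$ with components $A_a=A(\underline e_a)$ and curvature components $F_{ab}=A_{b;a}-A_{a;b}+[A_a,A_b]$, $F^{ab}=\kappa^{ac}\kappa^{bd}F_{cd}$, satisfies $F^{ab}{}_{;b}+[A_b,F^{ab}]=0$ on $U$, where $A_{b;a}=(dA_b-A_c\omega^c_b)(\underline e_a)$ and $F^{ab}{}_{;c}=(dF^{ab}+F^{db}\omega^a_d+F^{ad}\omega^b_d)(\underline e_c)$. -/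

import Mathlib

open scoped Manifold ContDiff

noncomputable section

namespace HVDW

/-! Conventions.  `M` is a smooth `n`-manifold, `G` a smooth Lie group of dimension `r`, `P` a smooth
`(n + r)`-manifold with a right action of `G`, written as a left action of `Gᵐᵒᵖ`.  Smooth means
`C^∞`.  Indices `a b c d : Fin n` are horizontal, `i j k : Fin r` vertical. -/

/-- The model space `ℝ^m`. -/
abbrev Eu (m : ℕ) : Type := EuclideanSpace ℝ (Fin m)

/-- The derivative `df_x(v)` of a vector-valued function on a manifold. -/
def dMap {m : ℕ} {N : Type*} [TopologicalSpace N] [ChartedSpace (Eu m) N]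
    {V : Type*} [NormedAddCommGroup V] [NormedSpace ℝ V]
    (f : N → V) (x : N) (v : TangentSpace (𝓡 m) x) : V :=
  mfderiv (𝓡 m) 𝓘(ℝ, V) f x v

/-- The Lie algebra `𝔤 = T_1 G`, with the bracket of left-invariant vector fields. -/
abbrev LieAlg (r : ℕ) (G : Type*) [TopologicalSpace G] [ChartedSpace (Eu r) G] [Group G] : Type :=
  GroupLieAlgebra (𝓡 r) G

section LieGroup

variable {r : ℕ} {G : Type*} [TopologicalSpace G] [ChartedSpace (Eu r) G] [Group G]

instance instFiniteDimensionalLieAlg : FiniteDimensional ℝ (LieAlg r G) :=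
  inferInstanceAs (FiniteDimensional ℝ (Eu r))

instance instLieGroupMinSmoothness [LieGroup (𝓡 r) ∞ G] :
    LieGroup (𝓡 r) (minSmoothness ℝ 3) G :=
  LieGroup.of_le (n := ∞) (by rw [minSmoothness_of_isRCLikeNormedField]; exact ENat.LEInfty.out)

/-- The adjoint action `Ad_g = d(h ↦ g h g⁻¹)_1` of `g` on `𝔤`. -/
def Ad (g : G) : LieAlg r G →L[ℝ] LieAlg r G :=
  mfderiv (𝓡 r) (𝓡 r) (fun h : G => g * h * g⁻¹) 1

/-- The adjoint action of `𝔤` on itself. -/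
def ad [LieGroup (𝓡 r) ∞ G] (ξ : LieAlg r G) : LieAlg r G →ₗ[ℝ] LieAlg r G :=
  (LieAlgebra.ad ℝ (LieAlg r G) ξ : Module.End ℝ (LieAlg r G))

variable (r G) in
/-- `𝔤` is unimodular: `tr (ad_ξ) = 0` for all `ξ`. -/
def IsUnimodular [LieGroup (𝓡 r) ∞ G] : Prop :=
  ∀ ξ : LieAlg r G, LinearMap.trace ℝ (LieAlg r G) (ad ξ) = 0

variable (r G) in
/-- A metric `h` on `𝔤` (of any signature), invariant under the adjoint action of `G`. -/
structure AdInvariantMetric where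
  form : LinearMap.BilinForm ℝ (LieAlg r G)
  symm : form.IsSymm
  nondeg : form.Nondegenerate
  ad_inv : ∀ (g : G) (ξ ζ : LieAlg r G), form (Ad g ξ) (Ad g ζ) = form ξ ζ

/-- `h^* : 𝔤^* → 𝔤`, the inverse of `h_* : 𝔤 → 𝔤^*`, `(h_* ξ)(ζ) = h(ξ, ζ)`. -/
def AdInvariantMetric.sharp (h : AdInvariantMetric r G) :
    Module.Dual ℝ (LieAlg r G) ≃ₗ[ℝ] LieAlg r G :=
  (h.form.toDual h.nondeg).symm

/-- The derivative `df_x(v)` of a `𝔤`-valued function on a manifold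
(`𝔤` is the vector space `ℝ^r`). -/
def dLie {m : ℕ} {N : Type*} [TopologicalSpace N] [ChartedSpace (Eu m) N]
    (f : N → LieAlg r G) (x : N) (v : TangentSpace (𝓡 m) x) : LieAlg r G :=
  dMap (V := Eu r) f x v

/-- The derivative `dℓ_x(v) ∈ 𝔤^*` of a `𝔤^*`-valued function on a manifold,
evaluated on `ξ ∈ 𝔤`. -/
def dDual {m : ℕ} {N : Type*} [TopologicalSpace N] [ChartedSpace (Eu m) N]
    (ℓ : N → Module.Dual ℝ (LieAlg r G)) (x : N) (v : TangentSpace (𝓡 m) x)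
    (ξ : LieAlg r G) : ℝ :=
  dMap (fun y => ℓ y ξ) x v

end LieGroup

/-- A smooth pseudo-Riemannian metric (of any signature). -/
structure PseudoRiemannianMetric (n : ℕ) (M : Type*) [TopologicalSpace M] [ChartedSpace (Eu n) M]
    [IsManifold (𝓡 n) ∞ M] where
  val : ∀ x : M, TangentSpace (𝓡 n) x →L[ℝ] TangentSpace (𝓡 n) x →L[ℝ] ℝ
  symm : ∀ (x : M) (v w : TangentSpace (𝓡 n) x), val x v w = val x w v
  nondeg : ∀ (x : M) (v : TangentSpace (𝓡 n) x),
    (∀ w : TangentSpace (𝓡 n) x, val x v w = 0) → v = 0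
  contMDiff : ContMDiff (𝓡 n) ((𝓡 n).prod 𝓘(ℝ, Eu n →L[ℝ] Eu n →L[ℝ] ℝ)) ∞
    (fun x => Bundle.TotalSpace.mk' (Eu n →L[ℝ] Eu n →L[ℝ] ℝ)
      (E := fun x : M => TangentSpace (𝓡 n) x →L[ℝ] TangentSpace (𝓡 n) x →L[ℝ] ℝ) x (val x))

section Bundle

variable {n r : ℕ}
  {M : Type*} [TopologicalSpace M] [ChartedSpace (Eu n) M]
  {G : Type*} [TopologicalSpace G] [ChartedSpace (Eu r) G] [Group G]
  {P : Type*} [TopologicalSpace P] [ChartedSpace (Eu (n + r)) P] [MulAction Gᵐᵒᵖ P]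

/-- The right action `R_g(z) = z · g`. -/
def rightAct (g : G) (z : P) : P := MulOpposite.op g • z

variable (n) in
/-- The infinitesimal action `ρ_ξ(z) = z · ξ`, the derivative at `1` of `g ↦ z · g` applied
to `ξ ∈ 𝔤 = T_1 G`. -/
def fundVec (ξ : LieAlg r G) (z : P) : TangentSpace (𝓡 (n + r)) z :=
  mfderiv (𝓡 r) (𝓡 (n + r)) (fun g : G => rightAct g z) 1 ξ

variable (n r G) in
/-- A smooth local section `σ` of `π : P → M` over an open set, such that
`(x, g) ↦ σ(x) · g` is a diffeomorphism onto `π⁻¹(base)`, with inverse `z ↦ (π z, fib z)`. -/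
structure LocalTriv (π : P → M) where
  base : Set M
  isOpen_base : IsOpen base
  sec : M → P
  contMDiffOn_sec : ContMDiffOn (𝓡 n) (𝓡 (n + r)) ∞ sec base
  proj_sec : ∀ x ∈ base, π (sec x) = x
  fib : P → G
  contMDiffOn_fib : ContMDiffOn (𝓡 (n + r)) (𝓡 r) ∞ fib (π ⁻¹' base)
  sec_act_fib : ∀ z, π z ∈ base → rightAct (fib z) (sec (π z)) = z
  fib_sec_act : ∀ x ∈ base, ∀ g : G, fib (rightAct g (sec x)) = g

variable (n r G) in
/-- `π : P → M` is a smooth principal bundle with structure group `G`, acting on the right. -/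
structure IsPrincipalBundle (π : P → M) : Prop where
  contMDiff_proj : ContMDiff (𝓡 (n + r)) (𝓡 n) ∞ π
  contMDiff_act : ContMDiff ((𝓡 (n + r)).prod (𝓡 r)) (𝓡 (n + r)) ∞
    (fun q : P × G => rightAct q.2 q.1)
  proj_act : ∀ (g : G) (z : P), π (rightAct g z) = π z
  exists_triv : ∀ x : M, ∃ T : LocalTriv n r G π, x ∈ T.base

variable (n r G P) in
/-- A `𝔤`-valued 1-form on `P`. -/
abbrev OneForm : Type _ := ∀ z : P, TangentSpace (𝓡 (n + r)) z →L[ℝ] LieAlg r G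

/-- Smoothness of a `𝔤`-valued 1-form, as a section of `𝔤 ⊗ T^*P`. -/
def OneForm.IsSmooth [IsManifold (𝓡 (n + r)) ∞ P] (η : OneForm n r G P) : Prop :=
  ContMDiff (𝓡 (n + r)) ((𝓡 (n + r)).prod 𝓘(ℝ, Eu (n + r) →L[ℝ] Eu r)) ∞
    (fun z => Bundle.TotalSpace.mk' (Eu (n + r) →L[ℝ] Eu r)
      (E := fun z : P => TangentSpace (𝓡 (n + r)) z →L[ℝ] Bundle.Trivial P (Eu r) z) z (η z))

/-- Normalization: `η_z(z · ξ) = ξ`. -/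
def OneForm.IsNormalized (η : OneForm n r G P) : Prop :=
  ∀ (z : P) (ξ : LieAlg r G), η z (fundVec n ξ z) = ξ

/-- Equivariance under one group element: `(R_g^* η)_z = Ad_{g⁻¹} ∘ η_z` for all `z`. -/
def OneForm.EquivariantUnder (η : OneForm n r G P) (g : G) : Prop :=
  ∀ (z : P) (v : TangentSpace (𝓡 (n + r)) z),
    η (rightAct g z) (mfderiv (𝓡 (n + r)) (𝓡 (n + r)) (rightAct g) z v) = Ad g⁻¹ (η z v)

/-- Equivariance: `R_g^* η = Ad_{g⁻¹} ∘ η` for all `g ∈ G`. -/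
def OneForm.IsEquivariant (η : OneForm n r G P) : Prop :=
  ∀ g : G, η.EquivariantUnder g

variable (n r G P) in
/-- A `𝔤^*`-valued differential form of degree `m` on `P`. -/
abbrev DualForm (m : ℕ) : Type _ :=
  ∀ z : P, TangentSpace (𝓡 (n + r)) z [⋀^Fin m]→ₗ[ℝ] Module.Dual ℝ (LieAlg r G)

variable (n r P) in
/-- A real valued differential form of degree `m` on `P`. -/
abbrev RealForm (m : ℕ) : Type _ :=
  ∀ z : P, TangentSpace (𝓡 (n + r)) z [⋀^Fin m]→ₗ[ℝ] ℝ

section Gauge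

variable [IsManifold (𝓡 n) ∞ M]

variable (n r G) in
/-- A local gauge: a local section `σ` of `P` and, on the same open set, a smooth moving frame
`(e_1, …, e_n)` of `M` with `⟨e_a, e_b⟩ = κ_ab` for the constant reference metric `κ`. -/
structure LocalGauge (π : P → M) (met : PseudoRiemannianMetric n M)
    (κ : Matrix (Fin n) (Fin n) ℝ) extends LocalTriv n r G π where
  e : Fin n → ∀ x : M, TangentSpace (𝓡 n) x
  contMDiffOn_e : ∀ a, ContMDiffOn (𝓡 n) (𝓡 n).tangent ∞
    (fun x => (⟨x, e a x⟩ : TangentBundle (𝓡 n) M)) base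
  met_e : ∀ a b, ∀ x ∈ base, met.val x (e a x) (e b x) = κ a b

namespace LocalGauge

variable {π : P → M} {met : PseudoRiemannianMetric n M} {κ : Matrix (Fin n) (Fin n) ℝ}
  (Γ : LocalGauge n r G π met κ)

/-- The coefficients `Γ^c_{ab} = ω^c_b(e_a)` of the Levi-Civita connection,
`∇_{e_a} e_b = Γ^c_{ab} e_c`, given by the Koszul formula in a frame with constant
inner products `κ`:
`2 ⟨∇_{e_a} e_b, e_d⟩ = ⟨[e_a, e_b], e_d⟩ - ⟨[e_b, e_d], e_a⟩ + ⟨[e_d, e_a], e_b⟩`. -/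
def leviCivita (c a b : Fin n) (x : M) : ℝ :=
  ∑ d, κ⁻¹ c d * ((1 / 2 : ℝ) *
    (met.val x (VectorField.mlieBracket (𝓡 n) (Γ.e a) (Γ.e b) x) (Γ.e d x)
      - met.val x (VectorField.mlieBracket (𝓡 n) (Γ.e b) (Γ.e d) x) (Γ.e a x)
      + met.val x (VectorField.mlieBracket (𝓡 n) (Γ.e d) (Γ.e a) x) (Γ.e b x)))

/-- The horizontal part of the moving frame on `P`: `e_a(z) = d(R_g ∘ σ)_x (e_a(x))`
at `z = σ(x) · g`. -/
def lift (a : Fin n) (z : P) : TangentSpace (𝓡 (n + r)) z :=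
  mfderiv (𝓡 n) (𝓡 (n + r)) (fun y => rightAct (Γ.fib z) (Γ.sec y)) (π z) (Γ.e a (π z))

/-- The moving frame `(e_1, …, e_n, ρ_1, …, ρ_r)` of `P`, where `ρ_j = ρ_{t_j}`. -/
def frame (t : Module.Basis (Fin r) ℝ (LieAlg r G)) (z : P) :
    Fin (n + r) → TangentSpace (𝓡 (n + r)) z :=
  Fin.append (fun a => Γ.lift a z) (fun j => fundVec n (t j) z)

/-- The component `η_a = η(e_a)`. -/
def comp (η : OneForm n r G P) (a : Fin n) (z : P) : LieAlg r G :=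
  η z (Γ.lift a z)

/-- The covariant derivative `η_{b;a} = (dη_b - η_c ω^c_b)(e_a)`. -/
def covComp (η : OneForm n r G P) (b a : Fin n) (z : P) : LieAlg r G :=
  dLie (Γ.comp η b) z (Γ.lift a z) - ∑ c, Γ.leviCivita c a b (π z) • Γ.comp η c z

/-- The `β^a ∧ β^b` component `η_{b;a} - η_{a;b} + [η_a, η_b]` of `dη + η ∧ η`. -/
def curv (η : OneForm n r G P) (a b : Fin n) (z : P) : LieAlg r G :=
  Γ.covComp η b a z - Γ.covComp η a b z + ⁅Γ.comp η a z, Γ.comp η b z⁆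

/-- The components in the moving frame, over the domain of the gauge, of a smooth `𝔤^*`-valued
form `p` of degree `k = n + r - 2`, where `vol = β ∧ γ`:
`p = -½ p^{ab} β_{ab} ∧ γ + (-1)^n p^{aj} β_a ∧ γ_j + ½ p^{jk} β ∧ γ_{jk}`.
The three families of forms are written through interior products with `vol`:
`β_{ab} ∧ γ = e_b ⌟ e_a ⌟ vol`, `(-1)^n β_a ∧ γ_j = - ρ_j ⌟ e_a ⌟ vol` and
`β ∧ γ_{jk} = ρ_k ⌟ ρ_j ⌟ vol`. -/
structure Components {k : ℕ} (vol : RealForm n r P (k + 2))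
    (t : Module.Basis (Fin r) ℝ (LieAlg r G)) (p : DualForm n r G P k) where
  pab : Fin n → Fin n → P → Module.Dual ℝ (LieAlg r G)
  paj : Fin n → Fin r → P → Module.Dual ℝ (LieAlg r G)
  pjk : Fin r → Fin r → P → Module.Dual ℝ (LieAlg r G)
  pab_antisymm : ∀ a b, ∀ z ∈ π ⁻¹' Γ.base, pab a b z = - pab b a z
  pjk_antisymm : ∀ j k, ∀ z ∈ π ⁻¹' Γ.base, pjk j k z = - pjk k j z
  smooth_pab : ∀ a b ξ, ContMDiffOn (𝓡 (n + r)) 𝓘(ℝ, ℝ) ∞ (fun z => pab a b z ξ) (π ⁻¹' Γ.base)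
  smooth_paj : ∀ a j ξ, ContMDiffOn (𝓡 (n + r)) 𝓘(ℝ, ℝ) ∞ (fun z => paj a j z ξ) (π ⁻¹' Γ.base)
  smooth_pjk : ∀ j k ξ, ContMDiffOn (𝓡 (n + r)) 𝓘(ℝ, ℝ) ∞ (fun z => pjk j k z ξ) (π ⁻¹' Γ.base)
  expand : ∀ z ∈ π ⁻¹' Γ.base, ∀ w : Fin k → TangentSpace (𝓡 (n + r)) z,
    p z w =
      - (1 / 2 : ℝ) • ∑ a, ∑ b,
          vol z (Matrix.vecCons (Γ.lift a z) (Matrix.vecCons (Γ.lift b z) w)) • pab a b z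
      - ∑ a, ∑ j,
          vol z (Matrix.vecCons (Γ.lift a z) (Matrix.vecCons (fundVec n (t j) z) w)) • paj a j z
      + (1 / 2 : ℝ) • ∑ i, ∑ j,
          vol z (Matrix.vecCons (fundVec n (t i) z) (Matrix.vecCons (fundVec n (t j) z) w)) • pjk i j z

section Equations

variable [LieGroup (𝓡 r) ∞ G] {k : ℕ} {vol : RealForm n r P (k + 2)}
  {t : Module.Basis (Fin r) ℝ (LieAlg r G)} {p : DualForm n r G P k}

/-- `p^{ab}_{;c} = (dp^{ab} + p^{db} ω^a_d + p^{ad} ω^b_d)(e_c)`, evaluated on `ξ`. -/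
def covPab (π_ab : Fin n → Fin n → P → Module.Dual ℝ (LieAlg r G)) (a b c : Fin n) (z : P)
    (ξ : LieAlg r G) : ℝ :=
  dDual (π_ab a b) z (Γ.lift c z) ξ
    + ∑ d, Γ.leviCivita a c d (π z) * π_ab d b z ξ
    + ∑ d, Γ.leviCivita b c d (π z) * π_ab a d z ξ

/-- The HVDW system over the domain of the gauge, for `η` and the components of `p`.
Horizontal indices are lowered with `κ`. The third equation, in `𝔤^*`, is
evaluated on `ξ ∈ 𝔤`, with `(ad_ζ^* ℓ)(ξ) = ℓ([ζ, ξ])`. -/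
structure Equations (h : AdInvariantMetric r G) (η : OneForm n r G P)
    (p' : Γ.Components vol t p) : Prop where
  first : ∀ z ∈ π ⁻¹' Γ.base, ∀ a b : Fin n,
    Γ.curv η a b z = h.sharp (∑ c, ∑ d, (κ a c * κ b d) • p'.pab c d z)
  second : ∀ z ∈ π ⁻¹' Γ.base, ∀ (a : Fin n) (j : Fin r),
    dLie (Γ.comp η a) z (fundVec n (t j) z) + ⁅t j, Γ.comp η a z⁆ = 0
  third : ∀ z ∈ π ⁻¹' Γ.base, ∀ (a : Fin n) (ξ : LieAlg r G),
    ∑ b, (Γ.covPab p'.pab a b b z ξ - p'.pab a b z ⁅Γ.comp η b z, ξ⁆)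
      + ∑ j, (dDual (p'.paj a j) z (fundVec n (t j) z) ξ - p'.paj a j z ⁅t j, ξ⁆
          - LinearMap.trace ℝ (LieAlg r G) (ad (t j)) * p'.paj a j z ξ) = 0

end Equations

/-- The gauge potential `A = σ^* η` on `M`, in the frame: `A_a = (σ^* η)(e_a)`. -/
def potential (η : OneForm n r G P) (a : Fin n) (x : M) : LieAlg r G :=
  η (Γ.sec x) (mfderiv (𝓡 n) (𝓡 (n + r)) Γ.sec x (Γ.e a x))

/-- `A_{b;a} = (dA_b - A_c ω^c_b)(e_a)`. -/
def covPotential (η : OneForm n r G P) (b a : Fin n) (x : M) : LieAlg r G :=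
  dLie (Γ.potential η b) x (Γ.e a x) - ∑ c, Γ.leviCivita c a b x • Γ.potential η c x

/-- The components `F_{ab} = A_{b;a} - A_{a;b} + [A_a, A_b]` of the curvature
`F = dA + ½[A ∧ A]`. -/
def fieldStrength (η : OneForm n r G P) (a b : Fin n) (x : M) : LieAlg r G :=
  Γ.covPotential η b a x - Γ.covPotential η a b x + ⁅Γ.potential η a x, Γ.potential η b x⁆

/-- `F^{ab}`, with the indices raised by the metric. -/
def fieldStrengthUp (η : OneForm n r G P) (a b : Fin n) (x : M) : LieAlg r G :=
  ∑ c, ∑ d, (κ⁻¹ a c * κ⁻¹ b d) • Γ.fieldStrength η c d x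

/-- The classical Yang-Mills equations `F^{ab}_{;b} + [A_b, F^{ab}] = 0` on the domain of the
gauge, where `F^{ab}_{;c} = (dF^{ab} + F^{db} ω^a_d + F^{ad} ω^b_d)(e_c)`. -/
def YangMills (η : OneForm n r G P) : Prop :=
  ∀ x ∈ Γ.base, ∀ a : Fin n,
    ∑ b, (dLie (Γ.fieldStrengthUp η a b) x (Γ.e b x)
      + ∑ d, Γ.leviCivita a b d x • Γ.fieldStrengthUp η d b x
      + ∑ d, Γ.leviCivita b b d x • Γ.fieldStrengthUp η a d x
      + ⁅Γ.potential η b x, Γ.fieldStrengthUp η a b x⁆) = 0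

end LocalGauge

variable (n r G) in
/-- The framing data: a set of local gauges whose domains cover `M`, and the volume form
`vol = β ∧ γ` on `P`, equal to `1` on the moving frame of each of these gauges. -/
structure GaugeAtlas (π : P → M) (met : PseudoRiemannianMetric n M)
    (κ : Matrix (Fin n) (Fin n) ℝ) (t : Module.Basis (Fin r) ℝ (LieAlg r G))
    (k : ℕ) (hk : k + 2 = n + r) where
  gauges : Set (LocalGauge n r G π met κ)
  cover : ∀ x : M, ∃ Γ ∈ gauges, x ∈ Γ.base
  vol : RealForm n r P (k + 2)
  vol_frame : ∀ Γ ∈ gauges, ∀ z ∈ π ⁻¹' Γ.base,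
    vol z (fun i => Γ.frame t z (Fin.cast hk i)) = 1

namespace GaugeAtlas

variable {π : P → M} {met : PseudoRiemannianMetric n M} {κ : Matrix (Fin n) (Fin n) ℝ}
  {t : Module.Basis (Fin r) ℝ (LieAlg r G)} {k : ℕ} {hk : k + 2 = n + r}
  (𝒜 : GaugeAtlas n r G π met κ t k hk)

/-- `(η, p)` solves the HVDW system: it does so in each gauge of the atlas. -/
def IsHVDWSolution [LieGroup (𝓡 r) ∞ G] (h : AdInvariantMetric r G)
    (η : OneForm n r G P) (p : DualForm n r G P k) : Prop :=
  ∀ Γ ∈ 𝒜.gauges, ∃ p' : Γ.Components 𝒜.vol t p, Γ.Equations h η p'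

/-- `η` solves the classical Yang-Mills equations: its local gauge potentials do so in each gauge
of the atlas. -/
def IsYangMills (η : OneForm n r G P) : Prop :=
  ∀ Γ ∈ 𝒜.gauges, Γ.YangMills η

end GaugeAtlas

end Gauge

end Bundle

end HVDW

end

/-! The second equation says that along each fibre `g ↦ η_a(z·g)` has derivative `-[ξ, η_a]` in the
direction of the left-invariant field of `ξ`. Hence `Ad_g η_a(z·g)` is locally constant in `g`, and
`η_a(z·g) = Ad_{g⁻¹} η_a(z)` on the identity component (`eq_adE_inv_of_mem_connectedComponent`,
`compE_rightAct`). Together with normalization on vertical vectors this is equivariance, checked on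
the moving frame.

For Yang–Mills, equivariance passes to the curvature (`curv_rightAct_sec`). The first equation and
the invariance of `h` then give `p^{ab}(σ(x)·g)(ξ) = h(F^{ab}(x), Ad_g ξ)`. Fix `x` and `ζ`, and
evaluate the third equation at `σ(x)·g` on `Ad_{g⁻¹} ζ`. Its `p^{ab}` part becomes `h(YM^a(x), ζ)`,
where `YM^a` is the left-hand side of the Yang–Mills equation; this does not depend on `g`
(`sum_covPab_eq`). Its `p^{aj}` part, without the trace term removed by unimodularity, is the sum
over `j` of the derivatives of `g ↦ p^{aj}(σ(x)·g)(Ad_{g⁻¹} ζ)` along the left-invariant fields of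
`t_j` (`dMap_paj_adE_inv`).

So a constant equals a divergence on the identity component of a compact group. Integrating against
a finite right-invariant measure shows that the constant is zero (`eq_zero_of_divergence_eq`), and
nondegeneracy of `h` gives `YM^a(x) = 0`.

The remaining input is that the derivative of `Ad` is the bracket of left-invariant fields, obtained
from the second derivative of the multiplication in a chart (`brE_eq`, `dMap_adE_inv`). -/

open scoped Topology

noncomputable section

namespace HVDW

/-! ### Calculus on manifolds through charts -/

section Calculus

variable {m : ℕ} {N : Type*} [TopologicalSpace N] [ChartedSpace (Eu m) N]
  {V : Type*} [NormedAddCommGroup V] [NormedSpace ℝ V]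

/-- The straight line through `x` with velocity `v` in the preferred chart at `x`. -/
def chartLine (x : N) (v : Eu m) (s : ℝ) : N :=
  (extChartAt (𝓡 m) x).symm (extChartAt (𝓡 m) x x + s • v)

@[simp]
theorem chartLine_zero (x : N) (v : Eu m) : chartLine x v 0 = x := by
  rw [chartLine, zero_smul, add_zero, extChartAt_to_inv]

/-- Reduces manifold derivatives to derivatives of functions of one real variable. Product rules and
identities between derivatives then follow from `HasDerivAt` and uniqueness of derivatives. -/
theorem hasDerivAt_comp_chartLine {f : N → V} {x : N}
    (hf : MDifferentiableAt (𝓡 m) 𝓘(ℝ, V) f x) (v : Eu m) :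
    HasDerivAt (fun s => f (chartLine x v s)) (dMap f x v) 0 := by
  have h := hf.hasMFDerivAt.2
  rw [ModelWithCorners.Boundaryless.range_eq_univ] at h
  have h' := hasFDerivWithinAt_univ.1 h
  have hl : HasDerivAt (fun s : ℝ => extChartAt (𝓡 m) x x + s • v) v 0 := by
    have := ((hasDerivAt_id (0 : ℝ)).smul_const v).const_add (extChartAt (𝓡 m) x x)
    rwa [one_smul] at this
  exact HasFDerivAt.comp_hasDerivAt_of_eq (0 : ℝ) h' hl (by rw [zero_smul, add_zero])

/-- In a chart, a small ball is convex and the function has zero derivative on it, so the mean value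
inequality applies. -/
theorem isLocallyConstant_of_dMap_eq_zero [IsManifold (𝓡 m) 1 N] {f : N → V}
    (hf : MDifferentiable (𝓡 m) 𝓘(ℝ, V) f)
    (h : ∀ x (v : TangentSpace (𝓡 m) x), dMap f x v = 0) : IsLocallyConstant f := by
  rw [IsLocallyConstant.iff_eventually_eq]
  intro x
  set φ := extChartAt (𝓡 m) x with hφ
  obtain ⟨ε, hε, hball⟩ := Metric.isOpen_iff.1 (isOpen_extChartAt_target (I := 𝓡 m) x) (φ x)
    (mem_extChartAt_target x)
  have hd : ∀ y ∈ Metric.ball (φ x) ε, HasFDerivAt (f ∘ φ.symm) (0 : Eu m →L[ℝ] V) y := by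
    intro y hy
    have h1 : HasMFDerivAt (𝓡 m) 𝓘(ℝ, V) f (φ.symm y) (0 : Eu m →L[ℝ] V) := by
      have h0 : mfderiv (𝓡 m) 𝓘(ℝ, V) f (φ.symm y) = 0 := ContinuousLinearMap.ext fun v => h _ v
      have := (hf (φ.symm y)).hasMFDerivAt
      rwa [h0] at this
    have h2 : MDifferentiableAt 𝓘(ℝ, Eu m) (𝓡 m) φ.symm y := by
      have := mdifferentiableWithinAt_extChartAt_symm (hball hy)
      rwa [ModelWithCorners.Boundaryless.range_eq_univ, mdifferentiableWithinAt_univ] at this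
    have h3 := h1.comp y h2.hasMFDerivAt
    exact (hasMFDerivAt_iff_hasFDerivAt.1 h3).congr_fderiv (ContinuousLinearMap.zero_comp _)
  have hc : ∀ y ∈ Metric.ball (φ x) ε, f (φ.symm y) = f x := by
    intro y hy
    have := (convex_ball (φ x) ε).is_const_of_fderivWithin_eq_zero (𝕜 := ℝ) (f := f ∘ φ.symm)
      (fun z hz => (hd z hz).differentiableAt.differentiableWithinAt)
      (fun z hz => by
        rw [fderivWithin_of_isOpen Metric.isOpen_ball hz, (hd z hz).fderiv]) hy
      (Metric.mem_ball_self hε)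
    simpa [hφ] using this
  filter_upwards [(continuousAt_extChartAt (I := 𝓡 m) x).preimage_mem_nhds
    (Metric.ball_mem_nhds (φ x) hε), extChartAt_source_mem_nhds (I := 𝓡 m) x] with y hy hy'
  have := hc _ hy
  rwa [hφ, (extChartAt (𝓡 m) x).left_inv hy'] at this

section Composition

variable {m' : ℕ} {N' : Type*} [TopologicalSpace N'] [ChartedSpace (Eu m') N']
  {m'' : ℕ} {N'' : Type*} [TopologicalSpace N''] [ChartedSpace (Eu m'') N'']

/-- The derivative of a map between manifolds, read as a map between the model spaces. -/
def tderiv (m m' : ℕ) {N : Type*} [TopologicalSpace N] [ChartedSpace (Eu m) N]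
    {N' : Type*} [TopologicalSpace N'] [ChartedSpace (Eu m') N'] (F : N → N') (x : N) : Eu m →L[ℝ] Eu m' :=
  mfderiv (𝓡 m) (𝓡 m') F x

theorem tderiv_comp {F : N → N'} {K : N' → N''} {x : N} {y : N'}
    (hK : MDifferentiableAt (𝓡 m') (𝓡 m'') K y) (hF : MDifferentiableAt (𝓡 m) (𝓡 m') F x)
    (hy : F x = y) (v : Eu m) :
    tderiv m m'' (fun z => K (F z)) x v = tderiv m' m'' K y (tderiv m m' F x v) :=
  mfderiv_comp_apply_of_eq (g := K) (f := F) x hK hF hy v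

theorem dMap_comp {F : N → N'} {f : N' → V} {x : N} {y : N'}
    (hf : MDifferentiableAt (𝓡 m') 𝓘(ℝ, V) f y) (hF : MDifferentiableAt (𝓡 m) (𝓡 m') F x)
    (hy : F x = y) (v : Eu m) :
    dMap (fun z => f (F z)) x v = dMap f y (tderiv m m' F x v) :=
  mfderiv_comp_apply_of_eq (g := f) (f := F) x hf hF hy v

theorem tderiv_id (x : N) (v : Eu m) : tderiv m m (fun z : N => z) x v = v :=
  congrArg (fun L : Eu m →L[ℝ] Eu m => L v) (mfderiv_id (I := 𝓡 m) (x := x))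

end Composition

theorem dMap_eq_fderiv {f : N → V} {x : N} (hf : MDifferentiableAt (𝓡 m) 𝓘(ℝ, V) f x)
    (v : Eu m) :
    dMap f x v =
      fderiv ℝ (fun y => f ((extChartAt (𝓡 m) x).symm y)) (extChartAt (𝓡 m) x x) v := by
  have h := hf.hasMFDerivAt.2
  rw [ModelWithCorners.Boundaryless.range_eq_univ] at h
  have h' : HasFDerivAt (fun y => f ((extChartAt (𝓡 m) x).symm y))
      (show Eu m →L[ℝ] V from mfderiv (𝓡 m) 𝓘(ℝ, V) f x) (extChartAt (𝓡 m) x x) :=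
    hasFDerivWithinAt_univ.1 h
  rw [h'.fderiv]
  rfl

end Calculus

/-! ### The adjoint action and its smoothness -/

section LieGroupCalculus

variable {r : ℕ} {G : Type*} [TopologicalSpace G] [ChartedSpace (Eu r) G] [Group G]

/-- The adjoint action, read as a map of the model space. -/
def adE (g : G) : Eu r →L[ℝ] Eu r := Ad g

/-- The bracket of the Lie algebra, read on the model space. -/
def brE (G : Type*) [TopologicalSpace G] [ChartedSpace (Eu r) G] [Group G] (ξ ζ : Eu r) : Eu r :=
  (⁅(show LieAlg r G from ξ), (show LieAlg r G from ζ)⁆ : LieAlg r G)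

variable [LieGroup (𝓡 r) ∞ G]

theorem mdifferentiable_mul_left (g : G) :
    MDifferentiable (𝓡 r) (𝓡 r) (fun h : G => g * h) :=
  (contMDiff_mul_left (I := 𝓡 r) (n := ∞) (a := g)).mdifferentiable (by simp)

theorem mdifferentiable_mul_right (g : G) :
    MDifferentiable (𝓡 r) (𝓡 r) (fun h : G => h * g) :=
  (contMDiff_mul_right (I := 𝓡 r) (n := ∞) (a := g)).mdifferentiable (by simp)

theorem mdifferentiable_conj (g : G) :
    MDifferentiable (𝓡 r) (𝓡 r) (fun h : G => g * h * g⁻¹) :=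
  (mdifferentiable_mul_right g⁻¹).comp (mdifferentiable_mul_left g)

omit [LieGroup (𝓡 r) ∞ G] in
theorem adE_one (ξ : Eu r) : adE (1 : G) ξ = ξ := by
  have h : adE (1 : G) = tderiv r r (fun h : G => 1 * h * 1⁻¹) 1 := rfl
  have h2 : (fun h : G => 1 * h * 1⁻¹) = fun h => h := by ext; simp
  rw [h, h2, tderiv_id]

theorem adE_mul (g k : G) (ξ : Eu r) : adE (g * k) ξ = adE g (adE k ξ) := by
  have h : adE (g * k) = tderiv r r (fun h : G => g * k * h * (g * k)⁻¹) 1 := rfl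
  have h2 : (fun h : G => g * k * h * (g * k)⁻¹) =
      fun h => (fun h : G => g * h * g⁻¹) ((fun h : G => k * h * k⁻¹) h) := by
    ext; simp [mul_assoc]
  rw [h, h2]
  exact tderiv_comp (K := fun h : G => g * h * g⁻¹) (F := fun h : G => k * h * k⁻¹)
    (mdifferentiable_conj g _) (mdifferentiable_conj k 1) (by simp) ξ

@[simp]
theorem adE_adE_inv (g : G) (ξ : Eu r) : adE g (adE g⁻¹ ξ) = ξ := by
  rw [← adE_mul, mul_inv_cancel, adE_one]

@[simp]
theorem adE_inv_adE (g : G) (ξ : Eu r) : adE g⁻¹ (adE g ξ) = ξ := by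
  rw [← adE_mul, inv_mul_cancel, adE_one]

/-- `Ad_g` is the partial derivative in `h` at `1` of the smooth map `(g, h) ↦ g h g⁻¹`, so it is
smooth in the parameter `g`. -/
theorem contMDiff_adE : ContMDiff (𝓡 r) 𝓘(ℝ, Eu r →L[ℝ] Eu r) ∞ (adE : G → Eu r →L[ℝ] Eu r) := by
  intro g₀
  have hconj : ContMDiff ((𝓡 r).prod (𝓡 r)) (𝓡 r) ∞
      (Function.uncurry fun g h : G => g * h * g⁻¹) :=
    (contMDiff_fst.mul contMDiff_snd).mul contMDiff_fst.inv
  have h := ContMDiffAt.mfderiv (n := ∞) (m := ∞) (I := 𝓡 r) (I' := 𝓡 r) (x₀ := g₀)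
    (fun g h : G => g * h * g⁻¹) (fun _ => 1) (hconj _) contMDiffAt_const (by simp)
  refine h.congr_of_eventuallyEq (Filter.Eventually.of_forall fun g => ?_)
  -- Source and target points are always `1`, so the coordinate changes of the tangent bundle are
  -- identities.
  have key : ∀ a b c : G, a = 1 → b = 1 → c = 1 → ∀ v : Eu r,
      (tangentBundleCore (𝓡 r) G).coordChange (achart (Eu r) a) (achart (Eu r) b) c v = v := by
    rintro _ _ _ rfl rfl rfl v
    exact (tangentBundleCore (𝓡 r) G).coordChange_self _ _ (mem_chart_source _ _) v
  refine Eq.trans ?_ (inTangentCoordinates_eq (I := 𝓡 r) (I' := 𝓡 r) (fun _ : G => (1 : G))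
    (fun g : G => g * 1 * g⁻¹) adE (mem_chart_source _ _) (by simp)).symm
  ext1 v
  exact ((key _ _ _ (by simp) (by simp) (by simp) _).trans
    (congrArg (adE g) (key _ _ _ rfl rfl rfl v))).symm

/-! ### The bracket as a second derivative of the multiplication -/

section Bracket

/-- The multiplication in the preferred chart at the identity. -/
def chartMul (G : Type*) [TopologicalSpace G] [ChartedSpace (Eu r) G] [Group G]
    (p : Eu r × Eu r) : Eu r :=
  extChartAt (𝓡 r) (1 : G)
    ((extChartAt (𝓡 r) (1 : G)).symm p.1 * (extChartAt (𝓡 r) (1 : G)).symm p.2)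

theorem contDiffAt_chartMul {x y : Eu r} (hx : x ∈ (extChartAt (𝓡 r) (1 : G)).target)
    (hy : y ∈ (extChartAt (𝓡 r) (1 : G)).target)
    (hxy : (extChartAt (𝓡 r) (1 : G)).symm x * (extChartAt (𝓡 r) (1 : G)).symm y ∈
      (extChartAt (𝓡 r) (1 : G)).source) :
    ContDiffAt ℝ ∞ (chartMul G) (x, y) := by
  have hs : ∀ z ∈ (extChartAt (𝓡 r) (1 : G)).target,
      ContMDiffAt 𝓘(ℝ, Eu r) (𝓡 r) ∞ (extChartAt (𝓡 r) (1 : G)).symm z := fun z hz =>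
    (contMDiffOn_extChartAt_symm (I := 𝓡 r) (1 : G)).contMDiffAt
      (extChartAt_target_mem_nhds' hz)
  have hf := contMDiffAt_extChartAt' (n := ∞) (I := 𝓡 r) (x := (1 : G))
    (by rwa [extChartAt_source] at hxy)
  have h1 : ContMDiffAt 𝓘(ℝ, Eu r × Eu r) (𝓡 r) ∞
      (fun p : Eu r × Eu r => (extChartAt (𝓡 r) (1 : G)).symm p.1) (x, y) :=
    ContMDiffAt.comp (x, y) (hs x hx) contDiff_fst.contDiffAt.contMDiffAt
  have h2 : ContMDiffAt 𝓘(ℝ, Eu r × Eu r) (𝓡 r) ∞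
      (fun p : Eu r × Eu r => (extChartAt (𝓡 r) (1 : G)).symm p.2) (x, y) :=
    ContMDiffAt.comp (x, y) (hs y hy) contDiff_snd.contDiffAt.contMDiffAt
  exact contMDiffAt_iff_contDiffAt.1 (ContMDiffAt.comp (x, y) hf (h1.mul h2))

theorem mdifferentiableAt_extChartAt_one_comp {F : G → G} {g : G}
    (hF : MDifferentiableAt (𝓡 r) (𝓡 r) F g)
    (hg : F g ∈ (extChartAt (𝓡 r) (1 : G)).source) :
    MDifferentiableAt (𝓡 r) 𝓘(ℝ, Eu r) (fun h => extChartAt (𝓡 r) (1 : G) (F h)) g :=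
  (mdifferentiableAt_extChartAt (I := 𝓡 r) (x := (1 : G))
    (by rwa [extChartAt_source] at hg)).comp g hF

theorem dMap_extChartAt_mul_left {x : Eu r} (hx : x ∈ (extChartAt (𝓡 r) (1 : G)).target)
    (ξ : Eu r) :
    dMap (fun h : G => extChartAt (𝓡 r) (1 : G) ((extChartAt (𝓡 r) (1 : G)).symm x * h)) 1 ξ =
      fderiv ℝ (chartMul G) (x, extChartAt (𝓡 r) (1 : G) 1) (0, ξ) := by
  have hm : (extChartAt (𝓡 r) (1 : G)).symm x * 1 ∈ (extChartAt (𝓡 r) (1 : G)).source := by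
    rw [mul_one]; exact (extChartAt (𝓡 r) (1 : G)).map_target hx
  rw [dMap_eq_fderiv (mdifferentiableAt_extChartAt_one_comp
    (mdifferentiable_mul_left _ _) hm)]
  have h1 : HasFDerivAt (chartMul G) (fderiv ℝ (chartMul G) (x, extChartAt (𝓡 r) (1 : G) 1))
      (x, extChartAt (𝓡 r) (1 : G) 1) :=
    ((contDiffAt_chartMul hx (mem_extChartAt_target 1)
      (by rwa [extChartAt_to_inv])).differentiableAt (by simp)).hasFDerivAt
  have h2 := h1.comp (extChartAt (𝓡 r) (1 : G) 1)
    (hasFDerivAt_prodMk_right x (extChartAt (𝓡 r) (1 : G) 1))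
  exact congrArg (fun L : Eu r →L[ℝ] Eu r => L ξ) h2.fderiv

theorem dMap_extChartAt_mul_right {x : Eu r} (hx : x ∈ (extChartAt (𝓡 r) (1 : G)).target)
    (ξ : Eu r) :
    dMap (fun h : G => extChartAt (𝓡 r) (1 : G) (h * (extChartAt (𝓡 r) (1 : G)).symm x)) 1 ξ =
      fderiv ℝ (chartMul G) (extChartAt (𝓡 r) (1 : G) 1, x) (ξ, 0) := by
  have hm : 1 * (extChartAt (𝓡 r) (1 : G)).symm x ∈ (extChartAt (𝓡 r) (1 : G)).source := by
    rw [one_mul]; exact (extChartAt (𝓡 r) (1 : G)).map_target hx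
  rw [dMap_eq_fderiv (mdifferentiableAt_extChartAt_one_comp
    (mdifferentiable_mul_right _ _) hm)]
  have h1 : HasFDerivAt (chartMul G) (fderiv ℝ (chartMul G) (extChartAt (𝓡 r) (1 : G) 1, x))
      (extChartAt (𝓡 r) (1 : G) 1, x) :=
    ((contDiffAt_chartMul (mem_extChartAt_target 1) hx
      (by rwa [extChartAt_to_inv])).differentiableAt (by simp)).hasFDerivAt
  have h2 := h1.comp (extChartAt (𝓡 r) (1 : G) 1)
    (hasFDerivAt_prodMk_left (𝕜 := ℝ) (extChartAt (𝓡 r) (1 : G) 1) x)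
  exact congrArg (fun L : Eu r →L[ℝ] Eu r => L ξ) h2.fderiv

/-- Differentiates `h g = g (g⁻¹ h g)` in `h` at `1`: right translation is left translation after
`Ad_{g⁻¹}`. -/
theorem dMap_extChartAt_mul_right_eq {x : Eu r} (hx : x ∈ (extChartAt (𝓡 r) (1 : G)).target)
    (ξ : Eu r) :
    fderiv ℝ (chartMul G) (extChartAt (𝓡 r) (1 : G) 1, x) (ξ, 0) =
      fderiv ℝ (chartMul G) (x, extChartAt (𝓡 r) (1 : G) 1)
        (0, adE ((extChartAt (𝓡 r) (1 : G)).symm x)⁻¹ ξ) := by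
  rw [← dMap_extChartAt_mul_left hx, ← dMap_extChartAt_mul_right hx]
  set g := (extChartAt (𝓡 r) (1 : G)).symm x with hg
  have hm : g * 1 ∈ (extChartAt (𝓡 r) (1 : G)).source := by
    rw [mul_one]; exact (extChartAt (𝓡 r) (1 : G)).map_target hx
  have h2 : (fun h : G => extChartAt (𝓡 r) (1 : G) (h * g)) =
      fun h => (fun h : G => extChartAt (𝓡 r) (1 : G) (g * h))
        ((fun h : G => g⁻¹ * h * g⁻¹⁻¹) h) := by
    ext1 h; simp [mul_assoc]
  rw [h2]
  exact dMap_comp (f := fun h : G => extChartAt (𝓡 r) (1 : G) (g * h))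
    (F := fun h : G => g⁻¹ * h * g⁻¹⁻¹)
    (mdifferentiableAt_extChartAt_one_comp (mdifferentiable_mul_left _ _) hm)
    (mdifferentiable_conj g⁻¹ 1) (by simp) ξ

/-- The pull-back applies the inverse of the derivative of the inverse chart, which is the
derivative of the chart. A left-invariant field thus reads in coordinates as the partial derivative
of `chartMul` in its second argument. -/
theorem mpullbackWithin_mulInvariantVectorField {x : Eu r}
    (hx : x ∈ (extChartAt (𝓡 r) (1 : G)).target) (ξ : Eu r) :
    (VectorField.mpullbackWithin 𝓘(ℝ, Eu r) (𝓡 r) (extChartAt (𝓡 r) (1 : G)).symm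
      (mulInvariantVectorField (I := 𝓡 r) (G := G) ξ) (Set.range (𝓡 r)) x : Eu r) =
      fderiv ℝ (chartMul G) (x, extChartAt (𝓡 r) (1 : G) 1) (0, ξ) := by
  rw [← dMap_extChartAt_mul_left hx]
  have hm : (extChartAt (𝓡 r) (1 : G)).symm x ∈ (extChartAt (𝓡 r) (1 : G)).source :=
    (extChartAt (𝓡 r) (1 : G)).map_target hx
  have h1 := ContinuousLinearMap.inverse_eq
    (mfderivWithin_extChartAt_symm_comp_mfderiv_extChartAt hx)
    (mfderiv_extChartAt_comp_mfderivWithin_extChartAt_symm hx)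
  have h2 := dMap_comp (f := extChartAt (𝓡 r) (1 : G))
    (F := fun h : G => (extChartAt (𝓡 r) (1 : G)).symm x * h)
    (mdifferentiableAt_extChartAt (I := 𝓡 r) (by rwa [extChartAt_source] at hm))
    (mdifferentiable_mul_left _ 1) (mul_one _) ξ
  rw [h2]
  exact congrArg (fun L : Eu r →L[ℝ] Eu r =>
    L (tderiv r r (fun h : G => (extChartAt (𝓡 r) (1 : G)).symm x * h) 1 ξ)) h1

theorem hasFDerivAt_fderiv_chartMul :
    HasFDerivAt (fderiv ℝ (chartMul G))
      (fderiv ℝ (fderiv ℝ (chartMul G)) (extChartAt (𝓡 r) (1 : G) 1, extChartAt (𝓡 r) (1 : G) 1))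
      (extChartAt (𝓡 r) (1 : G) 1, extChartAt (𝓡 r) (1 : G) 1) := by
  have h := contDiffAt_chartMul (mem_extChartAt_target (I := 𝓡 r) (1 : G))
    (mem_extChartAt_target (I := 𝓡 r) (1 : G)) (by simp)
  exact ((h.fderiv_right (m := 1) (by rw [one_add_one_eq_two]; exact ENat.LEInfty.out)).differentiableAt
    (by simp)).hasFDerivAt

theorem fderiv_chartMul_one_right (ξ : Eu r) :
    fderiv ℝ (chartMul G) (extChartAt (𝓡 r) (1 : G) 1, extChartAt (𝓡 r) (1 : G) 1) (0, ξ) = ξ := by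
  rw [← dMap_extChartAt_mul_left (mem_extChartAt_target (I := 𝓡 r) (1 : G)),
    extChartAt_to_inv]
  have : (fun h : G => extChartAt (𝓡 r) (1 : G) (1 * h)) = extChartAt (𝓡 r) (1 : G) := by
    ext1 h; rw [one_mul]
  rw [this]
  exact congrArg (fun L : Eu r →L[ℝ] Eu r => L ξ) (mfderiv_extChartAt_self (I := 𝓡 r) (x := (1 : G)))

/-- The bracket is the antisymmetrized mixed second derivative of the multiplication. -/
theorem brE_eq (ξ ζ : Eu r) :
    brE G ξ ζ =
      fderiv ℝ (fderiv ℝ (chartMul G))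
        (extChartAt (𝓡 r) (1 : G) 1, extChartAt (𝓡 r) (1 : G) 1) (ξ, 0) (0, ζ) -
      fderiv ℝ (fderiv ℝ (chartMul G))
        (extChartAt (𝓡 r) (1 : G) 1, extChartAt (𝓡 r) (1 : G) 1) (ζ, 0) (0, ξ) := by
  set x₀ := extChartAt (𝓡 r) (1 : G) 1 with hx₀
  let W : Eu r → Eu r → Eu r := fun ξ x => VectorField.mpullbackWithin 𝓘(ℝ, Eu r) (𝓡 r)
    (extChartAt (𝓡 r) (1 : G)).symm (mulInvariantVectorField (I := 𝓡 r) (G := G) ξ)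
    (Set.range (𝓡 r)) x
  have hW : ∀ ξ, W ξ =ᶠ[𝓝 x₀] fun x => fderiv ℝ (chartMul G) (x, x₀) (0, ξ) := fun ξ => by
    filter_upwards [extChartAt_target_mem_nhds (I := 𝓡 r) (1 : G)] with x hx
    exact mpullbackWithin_mulInvariantVectorField hx ξ
  have hW' : ∀ ξ ζ, fderiv ℝ (W ξ) x₀ ζ =
      fderiv ℝ (fderiv ℝ (chartMul G)) (x₀, x₀) (ζ, 0) (0, ξ) := fun ξ ζ => by
    rw [(hW ξ).fderiv_eq]
    have h1 : HasFDerivAt (fun x : Eu r => fderiv ℝ (chartMul G) (x, x₀)) _ x₀ :=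
      HasFDerivAt.comp (g := fderiv ℝ (chartMul G)) (f := fun x : Eu r => (x, x₀)) x₀
        hasFDerivAt_fderiv_chartMul (hasFDerivAt_prodMk_left (𝕜 := ℝ) x₀ x₀)
    rw [(h1.clm_apply (hasFDerivAt_const (0, ξ) x₀)).fderiv]
    simp
    rfl
  have hW0 : ∀ ξ, W ξ x₀ = ξ := fun ξ => by
    rw [(hW ξ).eq_of_nhds]; exact fderiv_chartMul_one_right ξ
  have hbr : brE G ξ ζ = VectorField.lieBracketWithin ℝ (W ξ) (W ζ) Set.univ x₀ := by
    have h := VectorField.mlieBracketWithin_apply (I := 𝓡 r) (x₀ := (1 : G)) (s := Set.univ)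
      (V := mulInvariantVectorField (I := 𝓡 r) (G := G) ξ)
      (W := mulInvariantVectorField (I := 𝓡 r) (G := G) ζ)
    have hset : ((extChartAt (𝓡 r) (1 : G)).symm ⁻¹' Set.univ ∩ Set.range (𝓡 r)) = Set.univ := by
      simp
    -- The preferred chart at `1` has identity derivative at `1`, so no correction appears on
    -- returning to the tangent space.
    have hinv : (mfderiv (𝓡 r) 𝓘(ℝ, Eu r) (extChartAt (𝓡 r) (1 : G)) 1).inverse =
        ContinuousLinearMap.id ℝ (Eu r) := by
      rw [mfderiv_extChartAt_self]; exact ContinuousLinearMap.inverse_id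
    rw [hset] at h
    exact h.trans (congrArg (fun L : Eu r →L[ℝ] Eu r =>
      L (VectorField.lieBracketWithin ℝ (W ξ) (W ζ) Set.univ x₀)) hinv)
  rw [hbr, VectorField.lieBracketWithin_univ, VectorField.lieBracket, hW0, hW0, hW', hW']

/-- The derivative of `g ↦ Ad_{g⁻¹} ζ` at the identity. -/
theorem dMap_adE_inv (ξ ζ : Eu r) : dMap (fun g : G => adE g⁻¹ ζ) 1 ξ = - brE G ξ ζ := by
  have hsm : ContMDiff (𝓡 r) 𝓘(ℝ, Eu r) ∞ (fun g : G => adE g⁻¹ ζ) :=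
    (contMDiff_adE.comp (contMDiff_inv (𝓡 r) ∞)).clm_apply contMDiff_const
  have hd := hsm.mdifferentiable (by simp) 1
  rw [dMap_eq_fderiv hd]
  set x₀ := extChartAt (𝓡 r) (1 : G) 1 with hx₀
  have hd' : DifferentiableAt ℝ (fun y => adE ((extChartAt (𝓡 r) (1 : G)).symm y)⁻¹ ζ) x₀ := by
    have h := hd.hasMFDerivAt.2
    rw [ModelWithCorners.Boundaryless.range_eq_univ] at h
    exact (hasFDerivWithinAt_univ.1 h).differentiableAt
  have hl : HasFDerivAt (fun x : Eu r => fderiv ℝ (chartMul G) (x₀, x)) _ x₀ :=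
    HasFDerivAt.comp (g := fderiv ℝ (chartMul G)) (f := fun x : Eu r => (x₀, x)) x₀
      hasFDerivAt_fderiv_chartMul (hasFDerivAt_prodMk_right (𝕜 := ℝ) x₀ x₀)
  have hr : HasFDerivAt (fun x : Eu r => fderiv ℝ (chartMul G) (x, x₀)) _ x₀ :=
    HasFDerivAt.comp (g := fderiv ℝ (chartMul G)) (f := fun x : Eu r => (x, x₀)) x₀
      hasFDerivAt_fderiv_chartMul (hasFDerivAt_prodMk_left (𝕜 := ℝ) x₀ x₀)
  have h1 := hl.clm_apply (hasFDerivAt_const ((ζ, 0) : Eu r × Eu r) x₀)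
  have h2 := hr.clm_apply ((hasFDerivAt_const (0 : Eu r) x₀).prodMk hd'.hasFDerivAt)
  -- Both sides of this identity are differentiated at `x₀` along `ξ`. The right side contributes a
  -- second derivative of `chartMul` plus the wanted derivative of `Ad_{g⁻¹} ζ`.
  have heq : (fun x : Eu r => fderiv ℝ (chartMul G) (x₀, x) (ζ, 0)) =ᶠ[𝓝 x₀]
      fun x => fderiv ℝ (chartMul G) (x, x₀)
        (0, adE ((extChartAt (𝓡 r) (1 : G)).symm x)⁻¹ ζ) := by
    filter_upwards [extChartAt_target_mem_nhds (I := 𝓡 r) (1 : G)] with x hx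
    exact dMap_extChartAt_mul_right_eq hx ζ
  have h3 := congrArg (fun L : Eu r →L[ℝ] Eu r => L ξ)
    ((h1.congr_of_eventuallyEq heq.symm).unique h2)
  -- Symmetry of the second derivative turns the left side into the other mixed term of `brE_eq`.
  have hsymm := (contDiffAt_chartMul (mem_extChartAt_target (I := 𝓡 r) (1 : G))
    (mem_extChartAt_target (I := 𝓡 r) (1 : G)) (by simp)).isSymmSndFDerivAt
      (by rw [minSmoothness_of_isRCLikeNormedField]; exact ENat.LEInfty.out) (0, ξ) (ζ, 0)
  have hone : adE ((extChartAt (𝓡 r) (1 : G)).symm x₀)⁻¹ ζ = ζ := by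
    rw [hx₀, extChartAt_to_inv, inv_one, adE_one]
  simp only [add_apply, ContinuousLinearMap.comp_apply,
    ContinuousLinearMap.flip_apply, ContinuousLinearMap.inl_apply, ContinuousLinearMap.inr_apply,
    ContinuousLinearMap.prod_apply, zero_apply, map_zero, zero_add] at h3
  rw [hone, hsymm, hx₀, fderiv_chartMul_one_right] at h3
  rw [brE_eq, h3]
  abel

end Bracket

end LieGroupCalculus

/-! ### Differential identities for the adjoint action -/

section AdjointCalculus

variable {r : ℕ} {G : Type*} [TopologicalSpace G] [ChartedSpace (Eu r) G] [Group G]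
  [LieGroup (𝓡 r) ∞ G]
  {V : Type*} [NormedAddCommGroup V] [NormedSpace ℝ V]

theorem mdifferentiable_adE :
    MDifferentiable (𝓡 r) 𝓘(ℝ, Eu r →L[ℝ] Eu r) (adE : G → Eu r →L[ℝ] Eu r) :=
  contMDiff_adE.mdifferentiable (by simp)

theorem contMDiff_adE_inv_apply (ζ : Eu r) :
    ContMDiff (𝓡 r) 𝓘(ℝ, Eu r) ∞ (fun g : G => adE g⁻¹ ζ) :=
  (contMDiff_adE.comp (contMDiff_inv (𝓡 r) ∞)).clm_apply contMDiff_const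

/-- The derivative of `g ↦ Ad_{g⁻¹} ζ` along the left-invariant field of `ξ`. -/
theorem dMap_adE_inv_mul_left (g : G) (ξ ζ : Eu r) :
    dMap (fun h : G => adE (g * h)⁻¹ ζ) 1 ξ = - brE G ξ (adE g⁻¹ ζ) := by
  rw [← dMap_adE_inv]
  congr 1
  ext1 h
  rw [mul_inv_rev, adE_mul]

/-- The derivative of `Ad` at the identity is `ad`. -/
theorem dMap_adE (ξ ζ : Eu r) :
    (dMap (adE : G → Eu r →L[ℝ] Eu r) 1 ξ) ζ = brE G ξ ζ := by
  have hA := hasDerivAt_comp_chartLine (mdifferentiable_adE (1 : G)) ξ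
  have hB := hasDerivAt_comp_chartLine
    ((contMDiff_adE_inv_apply (G := G) ζ).mdifferentiable (by simp) 1) ξ
  -- The curve `Ad_g (Ad_{g⁻¹} ζ)` is constantly `ζ`, so the two product-rule terms cancel.
  have h := hA.clm_apply hB
  simp only [adE_adE_inv, chartLine_zero, inv_one, adE_one, dMap_adE_inv] at h
  have h0 := h.unique (hasDerivAt_const (0 : ℝ) ζ)
  rwa [add_neg_eq_zero] at h0

theorem hasDerivAt_adE_chartLine {f : ℝ → Eu r} {f' : Eu r} (hf : HasDerivAt f f' 0) (ξ : Eu r) :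
    HasDerivAt (fun s => adE (chartLine (1 : G) ξ s) (f s)) (brE G ξ (f 0) + f') 0 := by
  have h := (hasDerivAt_comp_chartLine (mdifferentiable_adE (1 : G)) ξ).clm_apply hf
  rwa [dMap_adE, chartLine_zero, adE_one] at h

/-- Differentiates `Ad_g (Ad_h ζ) = Ad_{g h g⁻¹} (Ad_g ζ)` in `h` at `1`. -/
theorem adE_brE (g : G) (ξ ζ : Eu r) : adE g (brE G ξ ζ) = brE G (adE g ξ) (adE g ζ) := by
  have h1 := (adE g).hasFDerivAt.comp_hasDerivAt (0 : ℝ)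
    (hasDerivAt_adE_chartLine (G := G) (hasDerivAt_const (0 : ℝ) ζ) ξ)
  have hc : MDifferentiableAt (𝓡 r) 𝓘(ℝ, Eu r →L[ℝ] Eu r)
      (fun h : G => adE (g * h * g⁻¹)) 1 :=
    (mdifferentiable_adE _).comp (1 : G) (mdifferentiable_conj g 1)
  have h2 := (hasDerivAt_comp_chartLine hc ξ).clm_apply (hasDerivAt_const (0 : ℝ) (adE g ζ))
  have h3 : dMap (fun h : G => adE (g * h * g⁻¹)) 1 ξ = dMap (adE : G → _) 1 (adE g ξ) :=
    dMap_comp (f := (adE : G → Eu r →L[ℝ] Eu r)) (F := fun h : G => g * h * g⁻¹)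
      (mdifferentiable_adE 1) (mdifferentiable_conj g 1) (by simp) ξ
  rw [h3, dMap_adE, map_zero, add_zero] at h2
  rw [add_zero] at h1
  refine h1.unique (h2.congr_of_eventuallyEq (Filter.Eventually.of_forall fun s => ?_))
  simp [adE_mul]

/-- The infinitesimal form of `Ad`-invariance, from differentiating `h(Ad_g a, Ad_g b) = h(a, b)` at
`g = 1`. -/
theorem AdInvariantMetric.form_brE (h : AdInvariantMetric r G) (ξ a b : Eu r) :
    h.form (brE G ξ a) b + h.form a (brE G ξ b) = 0 := by
  let B : Eu r →L[ℝ] Eu r →L[ℝ] ℝ := LinearMap.toContinuousLinearMap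
    ((LinearMap.toContinuousLinearMap (𝕜 := ℝ) (E := Eu r) (F' := ℝ)).toLinearMap ∘ₗ
      (show Eu r →ₗ[ℝ] Eu r →ₗ[ℝ] ℝ from h.form))
  have hB : ∀ x y : Eu r, B x y = h.form x y := fun _ _ => rfl
  have ha := hasDerivAt_adE_chartLine (G := G) (hasDerivAt_const (0 : ℝ) a) ξ
  have hb := hasDerivAt_adE_chartLine (G := G) (hasDerivAt_const (0 : ℝ) b) ξ
  have hab := (B.hasFDerivAt.comp_hasDerivAt (0 : ℝ) ha).clm_apply hb
  have hc : ∀ s, B (adE (chartLine (1 : G) ξ s) a) (adE (chartLine (1 : G) ξ s) b) = B a b :=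
    fun s => h.ad_inv _ a b
  simp only [Function.comp_apply, hc, chartLine_zero, adE_one, add_zero] at hab
  exact hab.unique (hasDerivAt_const (0 : ℝ) _)

/-- Every tangent vector is a value of a left-invariant field. -/
theorem dMap_eq_dMap_mul_left {f : G → V} {g : G} (hf : MDifferentiableAt (𝓡 r) 𝓘(ℝ, V) f g)
    (v : Eu r) :
    dMap f g v = dMap (fun h : G => f (g * h)) 1 (tderiv r r (fun h : G => g⁻¹ * h) g v) := by
  have hg : MDifferentiableAt (𝓡 r) 𝓘(ℝ, V) f (g * 1) := by rwa [mul_one]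
  have h := dMap_comp (f := fun h : G => f (g * h)) (F := fun h : G => g⁻¹ * h)
    (MDifferentiableAt.comp (1 : G) hg (mdifferentiable_mul_left g 1))
    (mdifferentiable_mul_left g⁻¹ g) (inv_mul_cancel g) v
  simpa only [mul_inv_cancel_left] using h

/-- Along the left-invariant field of `ξ` the derivative of `Ad_g f(g)` is `Ad_g ([ξ, f(g)] - [ξ,
f(g)]) = 0`, and these fields span every tangent space. -/
theorem isLocallyConstant_adE_apply {f : G → Eu r} (hf : MDifferentiable (𝓡 r) 𝓘(ℝ, Eu r) f)
    (h : ∀ (g : G) (ξ : Eu r), dMap (fun k : G => f (g * k)) 1 ξ = - brE G ξ (f g)) :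
    IsLocallyConstant fun g => adE g (f g) := by
  have hF : MDifferentiable (𝓡 r) 𝓘(ℝ, Eu r) (fun g : G => adE g (f g)) := fun g =>
    (mdifferentiable_adE g).clm_apply (hf g)
  refine isLocallyConstant_of_dMap_eq_zero hF fun g v => ?_
  refine (dMap_eq_dMap_mul_left (hF g) v).trans ?_
  set ξ : Eu r := tderiv r r (fun h : G => g⁻¹ * h) g v
  have hd : MDifferentiableAt (𝓡 r) 𝓘(ℝ, Eu r) (fun k : G => f (g * k)) 1 :=
    MDifferentiableAt.comp (1 : G) (hf _) (mdifferentiable_mul_left g 1)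
  have hd' : MDifferentiableAt (𝓡 r) 𝓘(ℝ, Eu r) (fun k : G => adE (g * k) (f (g * k))) 1 :=
    MDifferentiableAt.comp (1 : G) (hF _) (mdifferentiable_mul_left g 1)
  have h1 := (adE g).hasFDerivAt.comp_hasDerivAt (0 : ℝ)
    (hasDerivAt_adE_chartLine (G := G) (hasDerivAt_comp_chartLine hd ξ) ξ)
  rw [chartLine_zero, mul_one, h, add_neg_cancel, map_zero] at h1
  refine (hasDerivAt_comp_chartLine hd' ξ).unique
    (h1.congr_of_eventuallyEq (Filter.Eventually.of_forall fun s => ?_))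
  simp [adE_mul]

theorem eq_adE_inv_of_mem_connectedComponent {f : G → Eu r}
    (hf : MDifferentiable (𝓡 r) 𝓘(ℝ, Eu r) f)
    (h : ∀ (g : G) (ξ : Eu r), dMap (fun k : G => f (g * k)) 1 ξ = - brE G ξ (f g))
    {g : G} (hg : g ∈ connectedComponent (1 : G)) : f g = adE g⁻¹ (f 1) := by
  have h1 := (isLocallyConstant_adE_apply hf h).apply_eq_of_isPreconnected
    isPreconnected_connectedComponent hg mem_connectedComponent
  simp only [adE_one] at h1
  rw [← h1, adE_inv_adE]

end AdjointCalculus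

/-! ### Integration over the compact group -/

section Integration

open MeasureTheory

variable {r : ℕ} {G : Type*} [TopologicalSpace G] [ChartedSpace (Eu r) G] [Group G]
  [LieGroup (𝓡 r) ∞ G]

/-- Joint continuity in `(g, s)` bounds the derivative uniformly on a compact set, which justifies
differentiating under the integral. -/
theorem continuousAt_deriv_mul_chartLine {q : G → ℝ} (hq : ContMDiff (𝓡 r) 𝓘(ℝ, ℝ) ∞ q)
    (ξ : Eu r) {s : ℝ}
    (hs : extChartAt (𝓡 r) (1 : G) 1 + s • ξ ∈ (extChartAt (𝓡 r) (1 : G)).target) (g : G) :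
    ContMDiffAt 𝓘(ℝ, ℝ) 𝓘(ℝ, ℝ) ∞ (fun u => q (g * chartLine (1 : G) ξ u)) s ∧
    ContinuousAt (fun p : G × ℝ => deriv (fun u => q (p.1 * chartLine (1 : G) ξ u)) p.2)
      (g, s) := by
  have hc : ContMDiffAt 𝓘(ℝ, ℝ) (𝓡 r) ∞ (chartLine (1 : G) ξ) s := by
    have h1 : ContMDiffAt 𝓘(ℝ, ℝ) 𝓘(ℝ, Eu r) ∞
        (fun u : ℝ => extChartAt (𝓡 r) (1 : G) 1 + u • ξ) s :=
      (contDiff_const.add (contDiff_id.smul contDiff_const)).contMDiff s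
    exact ContMDiffAt.comp s ((contMDiffOn_extChartAt_symm (I := 𝓡 r) (1 : G)).contMDiffAt
      (extChartAt_target_mem_nhds' hs)) h1
  refine ⟨ContMDiffAt.comp s (hq _) (contMDiffAt_const.mul hc), ?_⟩
  have hj : ContMDiffAt (((𝓡 r).prod 𝓘(ℝ, ℝ)).prod 𝓘(ℝ, ℝ)) 𝓘(ℝ, ℝ) ∞
      (Function.uncurry fun (p : G × ℝ) (u : ℝ) => q (p.1 * chartLine (1 : G) ξ u))
      ((g, s), s) := by
    have h1 : ContMDiffAt (((𝓡 r).prod 𝓘(ℝ, ℝ)).prod 𝓘(ℝ, ℝ)) (𝓡 r) ∞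
        (fun p : (G × ℝ) × ℝ => chartLine (1 : G) ξ p.2) ((g, s), s) :=
      ContMDiffAt.comp (I' := 𝓘(ℝ, ℝ)) (g := chartLine (1 : G) ξ) ((g, s), s) hc contMDiffAt_snd
    exact ContMDiffAt.comp (I' := 𝓡 r) ((g, s), s) (hq _)
      ((contMDiffAt_fst.comp ((g, s), s) contMDiffAt_fst).mul h1)
  have h := ContMDiffAt.mfderiv (n := ∞) (m := 0) (I := 𝓘(ℝ, ℝ)) (I' := 𝓘(ℝ, ℝ))
    (J := (𝓡 r).prod 𝓘(ℝ, ℝ)) (x₀ := (g, s))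
    (fun (p : G × ℝ) (u : ℝ) => q (p.1 * chartLine (1 : G) ξ u)) (fun p => p.2) hj
    contMDiffAt_snd (by simp)
  have h2 := (h.continuousAt).clm_apply (continuousAt_const (y := (1 : ℝ)))
  refine h2.congr (Filter.Eventually.of_forall fun p => ?_)
  have h3 := inTangentCoordinates_model_space (I := 𝓘(ℝ, ℝ)) (I' := 𝓘(ℝ, ℝ))
    (fun p : G × ℝ => p.2) (fun p : G × ℝ => q (p.1 * chartLine (1 : G) ξ p.2))
    (fun p : G × ℝ => (fderiv ℝ (fun u : ℝ => q (p.1 * chartLine (1 : G) ξ u)) p.2))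
    (g, s)
  have h4 := congrArg (fun L : ℝ →L[ℝ] ℝ => L 1) (congrFun h3 p)
  have h5 : (fun p : G × ℝ => (show ℝ →L[ℝ] ℝ from
      mfderiv 𝓘(ℝ, ℝ) 𝓘(ℝ, ℝ) (fun u : ℝ => q (p.1 * chartLine (1 : G) ξ u)) p.2)) =
      fun p => fderiv ℝ (fun u : ℝ => q (p.1 * chartLine (1 : G) ξ u)) p.2 :=
    funext fun p => mfderiv_eq_fderiv
  have h6 := congrArg (fun φ : G × ℝ → ℝ →L[ℝ] ℝ => inTangentCoordinates 𝓘(ℝ, ℝ) 𝓘(ℝ, ℝ)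
    (fun p : G × ℝ => p.2) (fun p : G × ℝ => q (p.1 * chartLine (1 : G) ξ p.2)) φ (g, s) p 1) h5
  exact (h6.trans h4).trans fderiv_apply_one_eq_deriv

/-- The integral of a derivative along a left-invariant field vanishes. -/
theorem integral_dMap_mul_left [CompactSpace G] [MeasurableSpace G] [BorelSpace G]
    (μ : Measure G) [IsFiniteMeasure μ] [μ.IsMulRightInvariant]
    {q : G → ℝ} (hq : ContMDiff (𝓡 r) 𝓘(ℝ, ℝ) ∞ q) (ξ : Eu r) :
    Integrable (fun g => dMap (fun h : G => q (g * h)) 1 ξ) μ ∧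
      ∫ g, dMap (fun h : G => q (g * h)) 1 ξ ∂μ = 0 := by
  have : IsTopologicalGroup G := topologicalGroup_of_lieGroup (𝓡 r) ∞
  have hmem : ∀ᶠ s in 𝓝 (0 : ℝ),
      extChartAt (𝓡 r) (1 : G) 1 + s • ξ ∈ (extChartAt (𝓡 r) (1 : G)).target := by
    have hcont : ContinuousAt (fun s : ℝ => extChartAt (𝓡 r) (1 : G) 1 + s • ξ) 0 := by fun_prop
    refine hcont.preimage_mem_nhds ?_
    rw [zero_smul, add_zero]
    exact extChartAt_target_mem_nhds (I := 𝓡 r) (1 : G)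
  obtain ⟨ε, hε, hball⟩ := Metric.nhds_basis_closedBall.eventually_iff.1 hmem
  have hcont : ContinuousOn
      (fun p : G × ℝ => deriv (fun u => q (p.1 * chartLine (1 : G) ξ u)) p.2)
      (Set.univ ×ˢ Metric.closedBall 0 ε) := fun p hp =>
    (continuousAt_deriv_mul_chartLine hq ξ (hball hp.2) p.1).2.continuousWithinAt
  obtain ⟨C, hC⟩ := (isCompact_univ.prod (isCompact_closedBall (0 : ℝ) ε)).exists_bound_of_continuousOn
    hcont
  have hd0 : ∀ g : G, deriv (fun u => q (g * chartLine (1 : G) ξ u)) 0 =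
      dMap (fun h : G => q (g * h)) 1 ξ := fun g =>
    (hasDerivAt_comp_chartLine (MDifferentiableAt.comp (1 : G)
      (hq.mdifferentiable (by simp) _) (mdifferentiable_mul_left g 1)) ξ).deriv
  have hF : ∀ u : ℝ, Continuous fun g : G => q (g * chartLine (1 : G) ξ u) := fun u =>
    hq.continuous.comp (continuous_mul_const _)
  have hint : ∀ {f : G → ℝ}, Continuous f → Integrable f μ := fun hf =>
    hf.integrable_of_hasCompactSupport (HasCompactSupport.of_compactSpace _)
  have hF' : Continuous fun g : G => deriv (fun u => q (g * chartLine (1 : G) ξ u)) 0 :=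
    continuous_iff_continuousAt.2 fun g => ContinuousAt.comp (f := fun g : G => (g, (0 : ℝ)))
      (continuousAt_deriv_mul_chartLine hq ξ (hball (Metric.mem_closedBall_self hε.le)) g).2
      (by fun_prop)
  have key := hasDerivAt_integral_of_dominated_loc_of_deriv_le (μ := μ) (x₀ := (0 : ℝ))
    (F := fun (u : ℝ) (g : G) => q (g * chartLine (1 : G) ξ u))
    (F' := fun (u : ℝ) (g : G) => deriv (fun u => q (g * chartLine (1 : G) ξ u)) u)
    (bound := fun _ => C) (Metric.closedBall_mem_nhds 0 hε)
    (Filter.Eventually.of_forall fun u => (hint (hF u)).aestronglyMeasurable)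
    (hint (hF 0)) (hint hF').aestronglyMeasurable
    (Filter.Eventually.of_forall fun g u hu => hC (g, u) ⟨trivial, hu⟩)
    (integrable_const C)
    (Filter.Eventually.of_forall fun g u hu =>
      (((continuousAt_deriv_mul_chartLine hq ξ (hball hu) g).1.contDiffAt.differentiableAt
        (by simp)).hasDerivAt))
  -- By right invariance the integral of `q (g * chartLine 1 ξ u)` does not depend on `u`, so its
  -- derivative at `0` vanishes.
  simp only [hd0, integral_mul_right_eq_self q] at key
  exact ⟨key.1, key.2.unique (hasDerivAt_const _ _)⟩

/-- A constant which is a left-invariant divergence over the identity component vanishes. -/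
theorem eq_zero_of_divergence_eq [CompactSpace G] {q : Fin r → G → ℝ}
    (hq : ∀ j, ContMDiff (𝓡 r) 𝓘(ℝ, ℝ) ∞ (q j)) (ξ : Fin r → Eu r) {c : ℝ}
    (h : ∀ g ∈ connectedComponent (1 : G), ∑ j, dMap (fun k : G => q j (g * k)) 1 (ξ j) = c) :
    c = 0 := by
  have : IsTopologicalGroup G := topologicalGroup_of_lieGroup (𝓡 r) ∞
  have : LocallyCompactSpace G := ChartedSpace.locallyCompactSpace (Eu r) G
  have : LocallyConnectedSpace G := ChartedSpace.locallyConnectedSpace (Eu r) G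
  let _ : MeasurableSpace G := borel G
  have : BorelSpace G := ⟨rfl⟩
  set K : Set G := connectedComponent 1 with hK
  have hKo : IsOpen K := isOpen_connectedComponent
  -- Haar measure is left invariant; inversion makes it right invariant, as derivatives along
  -- left-invariant fields require.
  let μ : Measure G := (Measure.haar : Measure G).inv
  have : IsFiniteMeasure μ := ⟨by
    rw [Measure.inv_apply, Set.inv_univ]; exact isCompact_univ.measure_lt_top⟩
  have hKpos : 0 < μ K := hKo.measure_pos μ ⟨1, mem_connectedComponent⟩
  classical
  -- The identity component is open and closed, so cutting off to it keeps the functions smooth and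
  -- allows integration over all of `G`.
  let q' : Fin r → G → ℝ := fun j => K.indicator (q j)
  have hq' : ∀ j, ContMDiff (𝓡 r) 𝓘(ℝ, ℝ) ∞ (q' j) := by
    intro j g
    by_cases hg : g ∈ K
    · refine (hq j g).congr_of_eventuallyEq ?_
      filter_upwards [hKo.mem_nhds hg] with k hk
      exact Set.indicator_of_mem hk _
    · refine (contMDiffAt_const (c := (0 : ℝ))).congr_of_eventuallyEq ?_
      filter_upwards [isClosed_connectedComponent.isOpen_compl.mem_nhds hg] with k hk
      exact Set.indicator_of_notMem hk _
  have hsum : ∀ g, ∑ j, dMap (fun k : G => q' j (g * k)) 1 (ξ j) = K.indicator (fun _ => c) g := by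
    intro g
    have hev : ∀ {S : Set G}, IsOpen S → g ∈ S → ∀ᶠ k in 𝓝 (1 : G), g * k ∈ S := by
      intro S hS hgS
      refine (continuous_const_mul g).continuousAt.eventually_mem (hS.mem_nhds ?_)
      rwa [mul_one]
    by_cases hg : g ∈ K
    · rw [Set.indicator_of_mem hg, ← h g hg]
      refine Finset.sum_congr rfl fun j _ => ?_
      have : (fun k : G => q' j (g * k)) =ᶠ[𝓝 1] fun k => q j (g * k) := by
        filter_upwards [hev hKo hg] with k hk
        exact Set.indicator_of_mem hk _
      exact congrArg (fun L : Eu r →L[ℝ] ℝ => L (ξ j)) this.mfderiv_eq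
    · rw [Set.indicator_of_notMem hg]
      refine Finset.sum_eq_zero fun j _ => ?_
      have : (fun k : G => q' j (g * k)) =ᶠ[𝓝 1] fun k => (0 : ℝ) := by
        filter_upwards [hev isClosed_connectedComponent.isOpen_compl hg] with k hk
        exact Set.indicator_of_notMem hk _
      exact congrArg (fun L : Eu r →L[ℝ] ℝ => L (ξ j)) (this.mfderiv_eq.trans mfderiv_const)
  have hI : ∫ g, K.indicator (fun _ => c) g ∂μ = 0 := by
    simp_rw [← hsum]
    rw [integral_finsetSum _ fun j _ => (integral_dMap_mul_left μ (hq' j) (ξ j)).1]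
    exact Finset.sum_eq_zero fun j _ => (integral_dMap_mul_left μ (hq' j) (ξ j)).2
  rw [integral_indicator hKo.measurableSet, setIntegral_const, smul_eq_mul, mul_eq_zero] at hI
  refine hI.resolve_left ?_
  exact (ENNReal.toReal_pos hKpos.ne' (measure_ne_top μ K)).ne'

end Integration

/-! ### Right translation, fundamental fields and horizontal lifts -/

section PrincipalBundle

variable {n r : ℕ}
  {M : Type*} [TopologicalSpace M] [ChartedSpace (Eu n) M]
  {G : Type*} [TopologicalSpace G] [ChartedSpace (Eu r) G] [Group G]
  {P : Type*} [TopologicalSpace P] [ChartedSpace (Eu (n + r)) P] [MulAction Gᵐᵒᵖ P]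
  {V : Type*} [NormedAddCommGroup V] [NormedSpace ℝ V]
  {π : P → M}

omit [TopologicalSpace G] [ChartedSpace (Eu r) G] [TopologicalSpace P]
  [ChartedSpace (Eu (n + r)) P] in
@[simp]
theorem rightAct_rightAct (g h : G) (z : P) :
    rightAct h (rightAct g z) = rightAct (g * h) z := by
  simp only [rightAct, smul_smul, MulOpposite.op_mul]

omit [TopologicalSpace G] [ChartedSpace (Eu r) G] [TopologicalSpace P]
  [ChartedSpace (Eu (n + r)) P] in
@[simp]
theorem rightAct_one (z : P) : rightAct (1 : G) z = z := by
  simp only [rightAct, MulOpposite.op_one, one_smul]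

theorem LocalTriv.fib_rightAct (T : LocalTriv n r G π)
    {z : P} (hz : π z ∈ T.base) (g : G) : T.fib (rightAct g z) = T.fib z * g := by
  conv_lhs => rw [← T.sec_act_fib z hz, rightAct_rightAct, T.fib_sec_act _ hz]

theorem LocalTriv.fib_sec (T : LocalTriv n r G π) {x : M} (hx : x ∈ T.base) :
    T.fib (T.sec x) = 1 := by
  conv_lhs => rw [← rightAct_one (G := G) (T.sec x), T.fib_sec_act _ hx]

theorem LocalTriv.proj_rightAct_sec (hπ : IsPrincipalBundle n r G π) (T : LocalTriv n r G π)
    {x : M} (hx : x ∈ T.base) (g : G) : π (rightAct g (T.sec x)) = x := by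
  rw [hπ.proj_act, T.proj_sec x hx]

theorem LocalTriv.mem_rightAct (hπ : IsPrincipalBundle n r G π) (T : LocalTriv n r G π)
    {z : P} (hz : z ∈ π ⁻¹' T.base) (g : G) : rightAct g z ∈ π ⁻¹' T.base := by
  rwa [Set.mem_preimage, hπ.proj_act]

theorem LocalTriv.sec_mem (T : LocalTriv n r G π) {x : M} (hx : x ∈ T.base) :
    T.sec x ∈ π ⁻¹' T.base := by
  rwa [Set.mem_preimage, T.proj_sec x hx]

theorem LocalTriv.isOpen_preimage (hπ : IsPrincipalBundle n r G π) (T : LocalTriv n r G π) :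
    IsOpen (π ⁻¹' T.base) :=
  T.isOpen_base.preimage hπ.contMDiff_proj.continuous

namespace IsPrincipalBundle

variable (hπ : IsPrincipalBundle n r G π)
include hπ

theorem contMDiff_rightAct (g : G) :
    ContMDiff (𝓡 (n + r)) (𝓡 (n + r)) ∞ (rightAct g : P → P) :=
  hπ.contMDiff_act.comp (contMDiff_id.prodMk contMDiff_const)

theorem contMDiff_orbit (z : P) :
    ContMDiff (𝓡 r) (𝓡 (n + r)) ∞ (fun g : G => rightAct g z) :=
  hπ.contMDiff_act.comp (contMDiff_const.prodMk contMDiff_id)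

theorem mdifferentiable_rightAct (g : G) :
    MDifferentiable (𝓡 (n + r)) (𝓡 (n + r)) (rightAct g : P → P) :=
  (hπ.contMDiff_rightAct g).mdifferentiable (by simp)

theorem mdifferentiable_orbit (z : P) :
    MDifferentiable (𝓡 r) (𝓡 (n + r)) (fun g : G => rightAct g z) :=
  (hπ.contMDiff_orbit z).mdifferentiable (by simp)

theorem dMap_fundVec {f : P → V} {z : P} (hf : MDifferentiableAt (𝓡 (n + r)) 𝓘(ℝ, V) f z)
    (ξ : LieAlg r G) :
    dMap f z (fundVec n ξ z) = dMap (fun h : G => f (rightAct h z)) 1 ξ :=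
  (dMap_comp (F := fun h : G => rightAct h z) hf (hπ.mdifferentiable_orbit z 1)
    (rightAct_one z) ξ).symm

/-- Differentiates `(z·h)·g = (z·g)·(g⁻¹ h g)` in `h` at `1`. -/
theorem tderiv_rightAct_fundVec [LieGroup (𝓡 r) ∞ G] (g : G) (z : P) (ξ : LieAlg r G) :
    tderiv (n + r) (n + r) (rightAct g : P → P) z (fundVec n ξ z) =
      fundVec n (Ad g⁻¹ ξ) (rightAct g z) := by
  have h1 := tderiv_comp (F := fun h : G => rightAct h z)
    (hπ.mdifferentiable_rightAct g z) (hπ.mdifferentiable_orbit z 1) (rightAct_one z) ξ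
  have h2 := tderiv_comp (F := fun h : G => g⁻¹ * h * g⁻¹⁻¹)
    (K := fun h : G => rightAct h (rightAct g z)) (hπ.mdifferentiable_orbit (rightAct g z) 1)
    (mdifferentiable_conj g⁻¹ 1) (by simp) ξ
  have h3 : (fun h : G => rightAct (g⁻¹ * h * g⁻¹⁻¹) (rightAct g z)) =
      fun h => rightAct g (rightAct h z) := by
    ext1 h
    simp [mul_assoc]
  rw [h3] at h2
  exact h1.symm.trans h2

end IsPrincipalBundle

namespace LocalGauge

variable [IsManifold (𝓡 n) ∞ M] {met : PseudoRiemannianMetric n M} {κ : Matrix (Fin n) (Fin n) ℝ}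
  (Γ : LocalGauge n r G π met κ) (hπ : IsPrincipalBundle n r G π)

theorem mdifferentiableAt_sec {x : M} (hx : x ∈ Γ.base) :
    MDifferentiableAt (𝓡 n) (𝓡 (n + r)) Γ.sec x :=
  (Γ.contMDiffOn_sec.contMDiffAt (Γ.isOpen_base.mem_nhds hx)).mdifferentiableAt (by simp)

include hπ in
theorem mdifferentiableAt_rightAct_sec (g : G) {x : M} (hx : x ∈ Γ.base) :
    MDifferentiableAt (𝓡 n) (𝓡 (n + r)) (fun y => rightAct g (Γ.sec y)) x :=
  (hπ.mdifferentiable_rightAct g _).comp x (Γ.mdifferentiableAt_sec hx)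

include hπ in
theorem dMap_lift {f : P → V} {x : M} (hx : x ∈ Γ.base) {g : G}
    (hf : MDifferentiableAt (𝓡 (n + r)) 𝓘(ℝ, V) f (rightAct g (Γ.sec x))) (a : Fin n) :
    dMap f (rightAct g (Γ.sec x)) (Γ.lift a (rightAct g (Γ.sec x))) =
      dMap (fun y => f (rightAct g (Γ.sec y))) x (Γ.e a x) := by
  have h := dMap_comp (F := fun y => rightAct g (Γ.sec y)) hf
    (Γ.mdifferentiableAt_rightAct_sec hπ g hx) rfl (Γ.e a x)
  have h2 : (Γ.lift a (rightAct g (Γ.sec x)) : Eu (n + r)) =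
      tderiv n (n + r) (fun y => rightAct g (Γ.sec y)) x (Γ.e a x) := by
    have hp := Γ.proj_rightAct_sec hπ hx g
    -- The group element and base point are generalized so that both equalities can be substituted
    -- despite the dependent tangent spaces.
    have : ∀ (g' : G) (x' : M), g' = g → x' = x →
        tderiv n (n + r) (fun y => rightAct g' (Γ.sec y)) x' (Γ.e a x') =
          tderiv n (n + r) (fun y => rightAct g (Γ.sec y)) x (Γ.e a x) := by
      rintro _ _ rfl rfl; rfl
    exact this _ _ (Γ.fib_sec_act x hx g) hp
  rw [h, ← h2]

include hπ in
theorem tderiv_rightAct_lift {z : P} (hz : z ∈ π ⁻¹' Γ.base) (g : G) (a : Fin n) :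
    tderiv (n + r) (n + r) (rightAct g : P → P) z (Γ.lift a z) = Γ.lift a (rightAct g z) := by
  have h1 := tderiv_comp (F := fun y => rightAct (Γ.fib z) (Γ.sec y))
    (hπ.mdifferentiable_rightAct g z) (Γ.mdifferentiableAt_rightAct_sec hπ (Γ.fib z) hz)
    (Γ.sec_act_fib z hz) (Γ.e a (π z))
  have : ∀ (g' : G) (x' : M), g' = Γ.fib z * g → x' = π z →
      tderiv n (n + r) (fun y => rightAct g' (Γ.sec y)) x' (Γ.e a x') =
        tderiv n (n + r) (fun y => rightAct (Γ.fib z * g) (Γ.sec y)) (π z) (Γ.e a (π z)) := by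
    rintro _ _ rfl rfl; rfl
  have h2 := this _ _ (Γ.fib_rightAct hz g) (hπ.proj_act g z)
  simp only [rightAct_rightAct] at h1
  exact h1.symm.trans h2.symm

-- The lift is the tangent map of `(x, g) ↦ σ(x)·g` applied to `(e_a, 0)`, composed with the smooth
-- inverse `z ↦ (π z, fib z)`.
include hπ in
theorem contMDiffOn_lift [LieGroup (𝓡 r) ∞ G] [IsManifold (𝓡 (n + r)) ∞ P] (a : Fin n) :
    ContMDiffOn (𝓡 (n + r)) (𝓡 (n + r)).tangent ∞
      (fun z => (⟨z, Γ.lift a z⟩ : TangentBundle (𝓡 (n + r)) P)) (π ⁻¹' Γ.base) := by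
  let Ψ : M × G → P := fun q => rightAct q.2 (Γ.sec q.1)
  have hopen : IsOpen (Γ.base ×ˢ (Set.univ : Set G)) := Γ.isOpen_base.prod isOpen_univ
  have hΨ : ContMDiffOn ((𝓡 n).prod (𝓡 r)) (𝓡 (n + r)) ∞ Ψ (Γ.base ×ˢ Set.univ) :=
    hπ.contMDiff_act.comp_contMDiffOn
      ((Γ.contMDiffOn_sec.comp contMDiffOn_fst fun q hq => hq.1).prodMk contMDiffOn_snd)
  have hT := hΨ.contMDiffOn_tangentMapWithin (m := ∞) (by simp) hopen.uniqueMDiffOn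
  have h1 : ContMDiffOn (𝓡 (n + r)) (𝓡 n).tangent ∞
      (fun z => (⟨π z, Γ.e a (π z)⟩ : TangentBundle (𝓡 n) M)) (π ⁻¹' Γ.base) :=
    (Γ.contMDiffOn_e a).comp hπ.contMDiff_proj.contMDiffOn fun z hz => hz
  have h2 : ContMDiffOn (𝓡 (n + r)) (𝓡 r).tangent ∞
      (fun z => (⟨Γ.fib z, 0⟩ : TangentBundle (𝓡 r) G)) (π ⁻¹' Γ.base) :=
    (Bundle.contMDiff_zeroSection ℝ (TangentSpace (𝓡 r) : G → Type _)).comp_contMDiffOn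
      Γ.contMDiffOn_fib
  have h3 := (contMDiff_equivTangentBundleProd_symm (I := 𝓡 n) (M := M) (I' := 𝓡 r) (M' := G)
    (n := ∞)).comp_contMDiffOn (h1.prodMk h2)
  have h4 := hT.comp h3 fun z hz =>
    (⟨hz, trivial⟩ : (π z, Γ.fib z) ∈ Γ.base ×ˢ (Set.univ : Set G))
  refine h4.congr fun z hz => ?_
  have hmk : ∀ (x y : P) (v w : Eu (n + r)), x = y → v = w →
      (⟨x, v⟩ : TangentBundle (𝓡 (n + r)) P) = ⟨y, w⟩ := by
    rintro _ _ _ _ rfl rfl; rfl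
  refine hmk _ _ _ _ (Γ.sec_act_fib z hz).symm ?_
  have hmem : (π z, Γ.fib z) ∈ Γ.base ×ˢ (Set.univ : Set G) := ⟨hz, trivial⟩
  have hd : MDifferentiableAt ((𝓡 n).prod (𝓡 r)) (𝓡 (n + r)) Ψ (π z, Γ.fib z) :=
    (hΨ.contMDiffAt (hopen.mem_nhds hmem)).mdifferentiableAt (by simp)
  have h5 := mfderiv_prod_eq_add_apply hd (v := ((Γ.e a (π z), 0) : Eu n × Eu r))
  have h6 : mfderivWithin ((𝓡 n).prod (𝓡 r)) (𝓡 (n + r)) Ψ (Γ.base ×ˢ Set.univ)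
      (π z, Γ.fib z) = mfderiv ((𝓡 n).prod (𝓡 r)) (𝓡 (n + r)) Ψ (π z, Γ.fib z) :=
    mfderivWithin_of_isOpen hopen hmem
  let L : Eu r →L[ℝ] Eu (n + r) := mfderiv (𝓡 r) (𝓡 (n + r)) (fun g : G => Ψ (π z, g)) (Γ.fib z)
  have h7 : ∀ v : Eu (n + r), v = v + L 0 := fun v => by rw [map_zero, add_zero]
  exact ((h7 (Γ.lift a z)).trans h5.symm).trans
    (congrArg (fun L : Eu n × Eu r →L[ℝ] Eu (n + r) => L (Γ.e a (π z), 0)) h6).symm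

/-- The component `η_a`, with values in the model space. -/
def compE (η : OneForm n r G P) (a : Fin n) (z : P) : Eu r := Γ.comp η a z

include hπ in
theorem contMDiffOn_compE [LieGroup (𝓡 r) ∞ G] [IsManifold (𝓡 (n + r)) ∞ P]
    {η : OneForm n r G P} (hη : η.IsSmooth) (a : Fin n) :
    ContMDiffOn (𝓡 (n + r)) 𝓘(ℝ, Eu r) ∞ (Γ.compE η a) (π ⁻¹' Γ.base) := by
  have h := ContMDiffOn.clm_bundle_apply (F₁ := Eu (n + r)) (F₂ := Eu r)
    (E₁ := (TangentSpace (𝓡 (n + r)) : P → Type _)) (E₂ := Bundle.Trivial P (Eu r))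
    (b := fun z : P => z) (ϕ := η) (v := fun z => Γ.lift a z)
    (ContMDiff.contMDiffOn hη) (Γ.contMDiffOn_lift hπ a)
  intro z hz
  exact (Bundle.contMDiffWithinAt_totalSpace.1 (h z hz)).2

end LocalGauge

end PrincipalBundle

/-! ### Pairing dual-valued curves with vectors -/

section DualCalculus

variable {r : ℕ} {G : Type*} [TopologicalSpace G] [ChartedSpace (Eu r) G] [Group G]

/-- A basis of the Lie algebra, read as a basis of the model space. -/
def basisE (t : Module.Basis (Fin r) ℝ (LieAlg r G)) : Module.Basis (Fin r) ℝ (Eu r) := t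

theorem dual_apply_eq_sum (t : Module.Basis (Fin r) ℝ (LieAlg r G))
    (ℓ : Module.Dual ℝ (LieAlg r G)) (v : Eu r) :
    ℓ v = ∑ i, (basisE t).equivFunL v i * ℓ (t i) := by
  have h := congrArg (ℓ : Eu r → ℝ) ((basisE t).sum_equivFun v).symm
  refine h.trans ((map_sum ℓ (fun i => (basisE t).equivFun v i • t i) Finset.univ).trans ?_)
  refine Finset.sum_congr rfl fun i _ => ?_
  exact (map_smul ℓ _ _).trans rfl

/-- The product rule for the pairing of a curve in the dual with a curve in the Lie algebra. -/
theorem hasDerivAt_dual_apply (t : Module.Basis (Fin r) ℝ (LieAlg r G))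
    {ℓ : ℝ → Module.Dual ℝ (LieAlg r G)} {ℓ' : Eu r → ℝ} {s₀ : ℝ}
    (hℓ : ∀ ξ : Eu r, HasDerivAt (fun s => ℓ s ξ) (ℓ' ξ) s₀)
    {v : ℝ → Eu r} {v' : Eu r} (hv : HasDerivAt v v' s₀) :
    HasDerivAt (fun s => ℓ s (v s)) (ℓ' (v s₀) + ℓ s₀ v') s₀ := by
  have hc : ∀ i, HasDerivAt (fun s => (basisE t).equivFunL (v s) i)
      ((basisE t).equivFunL v' i) s₀ := fun i =>
    hasDerivAt_pi.1 ((basisE t).equivFunL.toContinuousLinearMap.hasFDerivAt.comp_hasDerivAt s₀ hv) i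
  have h1 := HasDerivAt.fun_sum (u := Finset.univ) fun i _ => (hc i).mul (hℓ (t i))
  have h2 := HasDerivAt.fun_sum (u := Finset.univ) fun i _ =>
    (hasDerivAt_const s₀ ((basisE t).equivFunL (v s₀) i)).mul (hℓ (t i))
  -- Linearity of `ℓ'` is not assumed; its expansion in the basis follows from uniqueness of
  -- derivatives.
  have h3 : ℓ' (v s₀) = ∑ i, (basisE t).equivFunL (v s₀) i * ℓ' (t i) := by
    refine (hℓ (v s₀)).unique ((h2.congr_of_eventuallyEq
      (Filter.Eventually.of_forall fun s => dual_apply_eq_sum t (ℓ s) (v s₀))).congr_deriv ?_)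
    exact Finset.sum_congr rfl fun i _ => by rw [zero_mul, zero_add]
  refine (h1.congr_of_eventuallyEq
    (Filter.Eventually.of_forall fun s => dual_apply_eq_sum t (ℓ s) (v s))).congr_deriv ?_
  rw [h3, dual_apply_eq_sum t (ℓ s₀) v', ← Finset.sum_add_distrib]
  exact Finset.sum_congr rfl fun i _ => by ring

end DualCalculus

/-! ### Equivariance of the form and of its curvature -/

section Gauge

variable {n r : ℕ}
  {M : Type*} [TopologicalSpace M] [ChartedSpace (Eu n) M] [IsManifold (𝓡 n) ∞ M]
  {G : Type*} [TopologicalSpace G] [ChartedSpace (Eu r) G] [Group G] [LieGroup (𝓡 r) ∞ G]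
  {P : Type*} [TopologicalSpace P] [ChartedSpace (Eu (n + r)) P] [IsManifold (𝓡 (n + r)) ∞ P]
  [MulAction Gᵐᵒᵖ P]
  {π : P → M} {met : PseudoRiemannianMetric n M} {κ : Matrix (Fin n) (Fin n) ℝ}

omit [LieGroup (𝓡 r) ∞ G] [IsManifold (𝓡 (n + r)) ∞ P] in
/-- Two linear maps agreeing on the moving frame of a gauge agree. -/
theorem GaugeAtlas.linearMap_ext {t : Module.Basis (Fin r) ℝ (LieAlg r G)} {k : ℕ}
    {hk : k + 2 = n + r} (𝒜 : GaugeAtlas (P := P) n r G π met κ t k hk)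
    {Γ : LocalGauge n r G π met κ} (hΓ : Γ ∈ 𝒜.gauges) {z : P} (hz : z ∈ π ⁻¹' Γ.base)
    {V : Type*} [AddCommGroup V] [Module ℝ V] {L L' : Eu (n + r) →ₗ[ℝ] V}
    (h₁ : ∀ a, L (Γ.lift a z) = L' (Γ.lift a z))
    (h₂ : ∀ j, L (fundVec n (t j) z) = L' (fundVec n (t j) z)) : L = L' := by
  let b : Fin (k + 2) → Eu (n + r) := fun i => Γ.frame t z (Fin.cast hk i)
  -- An alternating form vanishes on dependent families, while `vol` is `1` on the frame; the count
  -- `k + 2 = n + r` then makes the frame a basis.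
  have hli : LinearIndependent ℝ b := by
    by_contra hb
    have := 𝒜.vol_frame Γ hΓ z hz
    exact one_ne_zero (this.symm.trans ((𝒜.vol z).map_linearDependent b hb))
  have hspan := hli.span_eq_top_of_card_eq_finrank' (by simp [hk])
  refine LinearMap.ext_on_range hspan fun i => ?_
  have : ∀ i, L (Γ.frame t z i) = L' (Γ.frame t z i) := by
    intro i
    refine Fin.addCases (fun a => ?_) (fun j => ?_) i
    · have : Γ.frame t z (Fin.castAdd r a) = Γ.lift a z := Fin.append_left _ _ a
      rw [this]; exact h₁ a
    · have : Γ.frame t z (Fin.natAdd n j) = fundVec n (t j) z := Fin.append_right _ _ j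
      rw [this]; exact h₂ j
  exact this _

namespace LocalGauge

variable (Γ : LocalGauge n r G π met κ) (hπ : IsPrincipalBundle n r G π)
  {η : OneForm n r G P}

/-- The second equation of the system, for all vertical directions. -/
def IsVerticallyCovariant (η : OneForm n r G P) : Prop :=
  ∀ z ∈ π ⁻¹' Γ.base, ∀ (a : Fin n) (ξ : LieAlg r G),
    dMap (Γ.compE η a) z (fundVec n ξ z) = - brE G ξ (Γ.compE η a z)

-- Both sides are linear in `ξ`, so the equation for the basis vectors `t_j` suffices.
omit [IsManifold (𝓡 (n + r)) ∞ P] in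
theorem Equations.isVerticallyCovariant {k : ℕ} {vol : RealForm n r P (k + 2)}
    {t : Module.Basis (Fin r) ℝ (LieAlg r G)} {p : DualForm n r G P k}
    {h : AdInvariantMetric r G} {p' : Γ.Components vol t p} (he : Γ.Equations h η p') :
    Γ.IsVerticallyCovariant η := by
  intro z hz a ξ
  let L₁ : Eu r →ₗ[ℝ] Eu r :=
    (show Eu (n + r) →L[ℝ] Eu r from
        mfderiv (𝓡 (n + r)) 𝓘(ℝ, Eu r) (Γ.compE η a) z).toLinearMap ∘ₗ
      (tderiv r (n + r) (fun g : G => rightAct g z) 1).toLinearMap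
  let L₂ : Eu r →ₗ[ℝ] Eu r := (show Eu r →ₗ[ℝ] Eu r from ad (Γ.comp η a z))
  have h12 : L₁ = L₂ := (basisE t).ext fun j => by
    have h1 := he.second z hz a j
    have h2 : (⁅Γ.comp η a z, t j⁆ : LieAlg r G) = - ⁅t j, Γ.comp η a z⁆ := (lie_skew _ _).symm
    exact (eq_neg_of_add_eq_zero_left h1).trans h2.symm
  have h3 := congrArg (fun L : Eu r →ₗ[ℝ] Eu r => L ξ) h12
  have h4 : (⁅Γ.comp η a z, (show LieAlg r G from ξ)⁆ : LieAlg r G) =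
    - ⁅(show LieAlg r G from ξ), Γ.comp η a z⁆ := (lie_skew _ _).symm
  exact h3.trans h4

include hπ in
theorem mdifferentiableAt_compE (hη : η.IsSmooth) {z : P} (hz : z ∈ π ⁻¹' Γ.base) (a : Fin n) :
    MDifferentiableAt (𝓡 (n + r)) 𝓘(ℝ, Eu r) (Γ.compE η a) z :=
  ((Γ.contMDiffOn_compE hπ hη a).contMDiffAt
    ((Γ.isOpen_preimage hπ).mem_nhds hz)).mdifferentiableAt (by simp)

include hπ in
theorem compE_rightAct (hη : η.IsSmooth) (hv : Γ.IsVerticallyCovariant η) {z : P}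
    (hz : z ∈ π ⁻¹' Γ.base) {g : G} (hg : g ∈ connectedComponent (1 : G)) (a : Fin n) :
    Γ.compE η a (rightAct g z) = adE g⁻¹ (Γ.compE η a z) := by
  have h := eq_adE_inv_of_mem_connectedComponent (G := G)
    (f := fun g => Γ.compE η a (rightAct g z)) ?_ ?_ hg
  · simpa using h
  · exact fun k => MDifferentiableAt.comp k
      (Γ.mdifferentiableAt_compE hπ hη (Γ.mem_rightAct hπ hz k) a) (hπ.mdifferentiable_orbit z k)
  · intro k ξ
    have hk := Γ.mem_rightAct hπ hz k
    have h1 := hπ.dMap_fundVec (Γ.mdifferentiableAt_compE hπ hη hk a) ξ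
    have h2 := hv _ hk a ξ
    simp only [rightAct_rightAct] at h1
    exact h1.symm.trans h2

/-- The gauge potential, with values in the model space. -/
def potentialE (η : OneForm n r G P) (a : Fin n) (x : M) : Eu r := Γ.potential η a x

omit [LieGroup (𝓡 r) ∞ G] [IsManifold (𝓡 (n + r)) ∞ P] in
theorem compE_sec {x : M} (hx : x ∈ Γ.base) (a : Fin n) :
    Γ.compE η a (Γ.sec x) = Γ.potentialE η a x := by
  have h2 : (Γ.lift a (Γ.sec x) : Eu (n + r)) = tderiv n (n + r) Γ.sec x (Γ.e a x) := by
    have : ∀ (g' : G) (x' : M), g' = 1 → x' = x →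
        tderiv n (n + r) (fun y => rightAct g' (Γ.sec y)) x' (Γ.e a x') =
          tderiv n (n + r) Γ.sec x (Γ.e a x) := by
      rintro _ _ rfl rfl
      simp only [rightAct_one]
    exact this _ _ (Γ.fib_sec hx) (Γ.proj_sec x hx)
  exact congrArg (fun v : Eu (n + r) => (show Eu r from η (Γ.sec x) v)) h2

include hπ in
theorem compE_rightAct_sec (hη : η.IsSmooth) (hv : Γ.IsVerticallyCovariant η) {x : M}
    (hx : x ∈ Γ.base) {g : G} (hg : g ∈ connectedComponent (1 : G)) (a : Fin n) :
    Γ.compE η a (rightAct g (Γ.sec x)) = adE g⁻¹ (Γ.potentialE η a x) := by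
  rw [Γ.compE_rightAct hπ hη hv (Γ.sec_mem hx) hg, Γ.compE_sec hx]

include hπ in
theorem mdifferentiableAt_potentialE (hη : η.IsSmooth) {x : M} (hx : x ∈ Γ.base) (a : Fin n) :
    MDifferentiableAt (𝓡 n) 𝓘(ℝ, Eu r) (Γ.potentialE η a) x := by
  have h := MDifferentiableAt.comp x (Γ.mdifferentiableAt_compE hπ hη (Γ.sec_mem hx) a)
    (Γ.mdifferentiableAt_sec hx)
  refine h.congr_of_eventuallyEq ?_
  filter_upwards [Γ.isOpen_base.mem_nhds hx] with y hy
  exact (Γ.compE_sec hy a).symm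

theorem dMap_clm_comp {m : ℕ} {N : Type*} [TopologicalSpace N] [ChartedSpace (Eu m) N]
    {V W : Type*} [NormedAddCommGroup V] [NormedSpace ℝ V] [NormedAddCommGroup W]
    [NormedSpace ℝ W] {f : N → V} {x : N} (hf : MDifferentiableAt (𝓡 m) 𝓘(ℝ, V) f x)
    (L : V →L[ℝ] W) (v : Eu m) : dMap (fun y => L (f y)) x v = L (dMap f x v) :=
  have hL : MDifferentiableAt (𝓡 m) 𝓘(ℝ, W) (fun y => L (f y)) x :=
    L.differentiable.mdifferentiable.mdifferentiableAt.comp x hf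
  (hasDerivAt_comp_chartLine hL v).unique
    (L.hasFDerivAt.comp_hasDerivAt (0 : ℝ) (hasDerivAt_comp_chartLine hf v))

include hπ in
theorem dMap_compE_lift (hη : η.IsSmooth) (hv : Γ.IsVerticallyCovariant η) {x : M}
    (hx : x ∈ Γ.base) {g : G} (hg : g ∈ connectedComponent (1 : G)) (a b : Fin n) :
    dMap (Γ.compE η b) (rightAct g (Γ.sec x)) (Γ.lift a (rightAct g (Γ.sec x))) =
      adE g⁻¹ (dMap (Γ.potentialE η b) x (Γ.e a x)) := by
  rw [Γ.dMap_lift hπ hx (Γ.mdifferentiableAt_compE hπ hη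
    (Γ.mem_rightAct hπ (Γ.sec_mem hx) g) b)]
  refine Eq.trans ?_ (dMap_clm_comp (Γ.mdifferentiableAt_potentialE hπ hη hx b) _ _)
  have : (fun y => Γ.compE η b (rightAct g (Γ.sec y))) =ᶠ[𝓝 x]
      fun y => adE g⁻¹ (Γ.potentialE η b y) := by
    filter_upwards [Γ.isOpen_base.mem_nhds hx] with y hy
    exact Γ.compE_rightAct_sec hπ hη hv hy hg b
  exact congrArg (fun L : Eu n →L[ℝ] Eu r => L (Γ.e a x)) this.mfderiv_eq

/-- The curvature components, with values in the model space. -/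
def fieldStrengthE (η : OneForm n r G P) (a b : Fin n) (x : M) : Eu r := Γ.fieldStrength η a b x

-- For fixed `g`, `Ad_{g⁻¹}` is a constant linear map preserving brackets, so it passes through the
-- derivative, connection and commutator terms.
include hπ in
theorem curv_rightAct_sec (hη : η.IsSmooth) (hv : Γ.IsVerticallyCovariant η) {x : M}
    (hx : x ∈ Γ.base) {g : G} (hg : g ∈ connectedComponent (1 : G)) (a b : Fin n) :
    Γ.curv η a b (rightAct g (Γ.sec x)) = adE g⁻¹ (Γ.fieldStrengthE η a b x) := by
  have hcov : ∀ a b, Γ.covComp η b a (rightAct g (Γ.sec x)) =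
      adE g⁻¹ (show Eu r from Γ.covPotential η b a x) := by
    intro a b
    have h1 : (show Eu r from Γ.covComp η b a (rightAct g (Γ.sec x))) =
      dMap (Γ.compE η b) (rightAct g (Γ.sec x)) (Γ.lift a (rightAct g (Γ.sec x))) -
        ∑ c, Γ.leviCivita c a b (π (rightAct g (Γ.sec x))) •
          Γ.compE η c (rightAct g (Γ.sec x)) := rfl
    have h2 : (show Eu r from Γ.covPotential η b a x) = dMap (Γ.potentialE η b) x (Γ.e a x) -
        ∑ c, Γ.leviCivita c a b x • Γ.potentialE η c x := rfl
    refine h1.trans ?_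
    rw [h2, Γ.dMap_compE_lift hπ hη hv hx hg, Γ.proj_rightAct_sec hπ hx, map_sub, map_sum]
    simp only [map_smul, Γ.compE_rightAct_sec hπ hη hv hx hg]
  have h3 : (show Eu r from Γ.curv η a b (rightAct g (Γ.sec x))) =
    (show Eu r from Γ.covComp η b a (rightAct g (Γ.sec x))) -
      (show Eu r from Γ.covComp η a b (rightAct g (Γ.sec x))) +
      brE G (Γ.compE η a (rightAct g (Γ.sec x))) (Γ.compE η b (rightAct g (Γ.sec x))) := rfl
  have h4 : Γ.fieldStrengthE η a b x =
    (show Eu r from Γ.covPotential η b a x) - (show Eu r from Γ.covPotential η a b x) +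
      brE G (Γ.potentialE η a x) (Γ.potentialE η b x) := rfl
  refine h3.trans ?_
  rw [h4, map_add, map_sub, adE_brE, ← Γ.compE_rightAct_sec hπ hη hv hx hg,
    ← Γ.compE_rightAct_sec hπ hη hv hx hg, ← hcov, ← hcov]

end LocalGauge

/-- Equivariance under the identity component. -/
theorem GaugeAtlas.equivariantUnder {t : Module.Basis (Fin r) ℝ (LieAlg r G)} {k : ℕ}
    {hk : k + 2 = n + r} (𝒜 : GaugeAtlas (P := P) n r G π met κ t k hk)
    (hπ : IsPrincipalBundle n r G π) {η : OneForm n r G P} (hη : η.IsSmooth)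
    (hηn : η.IsNormalized) (hv : ∀ Γ ∈ 𝒜.gauges, Γ.IsVerticallyCovariant η)
    {g : G} (hg : g ∈ connectedComponent (1 : G)) : η.EquivariantUnder g := by
  intro z v
  obtain ⟨Γ, hΓ, hz⟩ := 𝒜.cover (π z)
  let L₁ : Eu (n + r) →ₗ[ℝ] Eu r :=
    (show Eu (n + r) →L[ℝ] Eu r from η (rightAct g z)).toLinearMap ∘ₗ
      (tderiv (n + r) (n + r) (rightAct g : P → P) z).toLinearMap
  let L₂ : Eu (n + r) →ₗ[ℝ] Eu r :=
    (adE g⁻¹).toLinearMap ∘ₗ (show Eu (n + r) →L[ℝ] Eu r from η z).toLinearMap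
  have h : L₁ = L₂ := by
    -- On horizontal vectors this is `compE_rightAct`; on vertical ones, normalization and the
    -- transformation of fundamental fields.
    refine 𝒜.linearMap_ext hΓ hz (fun a => ?_) (fun j => ?_)
    · exact (congrArg (show Eu (n + r) →L[ℝ] Eu r from η (rightAct g z))
        (Γ.tderiv_rightAct_lift hπ hz g a)).trans (Γ.compE_rightAct hπ hη (hv Γ hΓ) hz hg a)
    · refine (congrArg (show Eu (n + r) →L[ℝ] Eu r from η (rightAct g z))
        (hπ.tderiv_rightAct_fundVec g z (t j))).trans ((hηn _ _).trans ?_)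
      exact (congrArg (adE g⁻¹) (hηn z (t j))).symm
  exact congrArg (fun L : Eu (n + r) →ₗ[ℝ] Eu r => L v) h

end Gauge

/-! ### The invariant metric and raising of indices -/

section Form

variable {r : ℕ} {G : Type*} [TopologicalSpace G] [ChartedSpace (Eu r) G] [Group G]
  (h : AdInvariantMetric r G)

/-- The invariant metric as a continuous bilinear form on the model space. -/
def AdInvariantMetric.formL : Eu r →L[ℝ] Eu r →L[ℝ] ℝ :=
  LinearMap.toContinuousLinearMap
    ((LinearMap.toContinuousLinearMap (𝕜 := ℝ) (E := Eu r) (F' := ℝ)).toLinearMap ∘ₗ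
      (show Eu r →ₗ[ℝ] Eu r →ₗ[ℝ] ℝ from h.form))

theorem AdInvariantMetric.formL_adE (g : G) (a b : Eu r) :
    h.formL (adE g a) (adE g b) = h.formL a b := h.ad_inv g a b

theorem AdInvariantMetric.formL_sharp (ℓ : Module.Dual ℝ (LieAlg r G)) (ξ : LieAlg r G) :
    h.formL (h.sharp ℓ) ξ = ℓ ξ :=
  LinearMap.BilinForm.apply_toDual_symm_apply (hB := h.nondeg) ℓ ξ

theorem AdInvariantMetric.sharp_eq {ℓ : Module.Dual ℝ (LieAlg r G)} {v : Eu r}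
    (hv : ∀ ξ : Eu r, h.formL v ξ = ℓ ξ) : (h.sharp ℓ : Eu r) = v := by
  have : h.form.toDual h.nondeg v = ℓ := LinearMap.ext fun ξ => hv ξ
  exact (LinearEquiv.symm_apply_eq _).2 this.symm

theorem AdInvariantMetric.eq_zero_of_formL {v : Eu r} (hv : ∀ ξ : Eu r, h.formL v ξ = 0) :
    v = 0 := by
  have h1 := h.sharp_eq (ℓ := 0) hv
  exact h1.symm.trans (map_zero h.sharp)

theorem AdInvariantMetric.formL_brE [LieGroup (𝓡 r) ∞ G] (ξ a b : Eu r) :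
    h.formL (brE G ξ a) b = - h.formL a (brE G ξ b) :=
  eq_neg_of_add_eq_zero_left (h.form_brE ξ a b)

end Form

/-- In matrix form `Y = κ X κᵀ`, hence `X = κ⁻¹ Y (κ⁻¹)ᵀ`. -/
theorem eq_sum_inv_mul_of_eq_sum {n : ℕ} {κ : Matrix (Fin n) (Fin n) ℝ} (hκ : κ.det ≠ 0)
    {X Y : Fin n → Fin n → ℝ} (h : ∀ a b, Y a b = ∑ c, ∑ d, κ a c * κ b d * X c d)
    (c d : Fin n) : X c d = ∑ a, ∑ b, κ⁻¹ c a * κ⁻¹ d b * Y a b := by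
  have hY : Matrix.of Y = κ * Matrix.of X * κ.transpose := by
    ext a b
    simp only [Matrix.of_apply, h, Matrix.mul_apply, Matrix.transpose_apply, Finset.sum_mul]
    rw [Finset.sum_comm]
    exact Finset.sum_congr rfl fun _ _ => Finset.sum_congr rfl fun _ _ => by ring
  have hu : IsUnit κ.det := isUnit_iff_ne_zero.2 hκ
  have hX : Matrix.of X = κ⁻¹ * Matrix.of Y * (κ⁻¹).transpose := by
    rw [hY, Matrix.transpose_nonsing_inv]
    simp only [← Matrix.mul_assoc, Matrix.nonsing_inv_mul κ hu, Matrix.one_mul]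
    rw [Matrix.mul_assoc, Matrix.mul_nonsing_inv _ (by rwa [Matrix.det_transpose]), Matrix.mul_one]
  have := congrFun (congrFun hX c) d
  simp only [Matrix.of_apply, Matrix.mul_apply, Matrix.transpose_apply, Finset.sum_mul] at this
  rw [this, Finset.sum_comm]
  exact Finset.sum_congr rfl fun _ _ => Finset.sum_congr rfl fun _ _ => by ring

/-! ### From the third equation to Yang–Mills -/

namespace LocalGauge

variable {n r : ℕ}
  {M : Type*} [TopologicalSpace M] [ChartedSpace (Eu n) M] [IsManifold (𝓡 n) ∞ M]
  {G : Type*} [TopologicalSpace G] [ChartedSpace (Eu r) G] [Group G] [LieGroup (𝓡 r) ∞ G]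
  {P : Type*} [TopologicalSpace P] [ChartedSpace (Eu (n + r)) P] [IsManifold (𝓡 (n + r)) ∞ P]
  [MulAction Gᵐᵒᵖ P]
  {π : P → M} {met : PseudoRiemannianMetric n M} {κ : Matrix (Fin n) (Fin n) ℝ}
  (Γ : LocalGauge n r G π met κ) (hπ : IsPrincipalBundle n r G π)
  {η : OneForm n r G P} {h : AdInvariantMetric r G}
  {k : ℕ} {vol : RealForm n r P (k + 2)} {t : Module.Basis (Fin r) ℝ (LieAlg r G)}
  {p : DualForm n r G P k} {p' : Γ.Components vol t p}

/-- The curvature components with raised indices, with values in the model space. -/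
def fieldStrengthUpE (η : OneForm n r G P) (a b : Fin n) (x : M) : Eu r :=
  Γ.fieldStrengthUp η a b x

-- Ties `p^{ab}` on the whole identity-component orbit of `σ(x)` to the curvature at `x`: raise
-- indices in the first equation, use `curv_rightAct_sec`, and move `Ad` across by invariance of
-- `h`.
include hπ in
theorem formL_fieldStrengthUpE (hκ : κ.det ≠ 0) (hη : η.IsSmooth) (he : Γ.Equations h η p')
    {x : M} (hx : x ∈ Γ.base) {g : G} (hg : g ∈ connectedComponent (1 : G)) (c d : Fin n)
    (ξ : Eu r) :
    h.formL (Γ.fieldStrengthUpE η c d x) (adE g ξ) = p'.pab c d (rightAct g (Γ.sec x)) ξ := by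
  have hz := Γ.mem_rightAct hπ (Γ.sec_mem hx) g
  have hY : ∀ a b, h.formL (Γ.curv η a b (rightAct g (Γ.sec x))) ξ =
      ∑ c, ∑ d, κ a c * κ b d * p'.pab c d (rightAct g (Γ.sec x)) ξ := by
    intro a b
    have hsum : ∀ (w : Fin n → Fin n → ℝ) (ℓ : Fin n → Fin n → Module.Dual ℝ (LieAlg r G))
        (ζ : LieAlg r G), (∑ c, ∑ d, w c d • ℓ c d) ζ = ∑ c, ∑ d, w c d * ℓ c d ζ := by
      intro w ℓ ζ
      simp only [LinearMap.sum_apply, LinearMap.smul_apply, smul_eq_mul]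
    rw [he.first _ hz a b]
    exact (h.formL_sharp _ ξ).trans (hsum _ _ ξ)
  refine Eq.trans ?_ (eq_sum_inv_mul_of_eq_sum hκ hY c d).symm
  have h1 : Γ.fieldStrengthUpE η c d x =
    ∑ a, ∑ b, (κ⁻¹ c a * κ⁻¹ d b) • Γ.fieldStrengthE η a b x := rfl
  rw [h1]
  simp only [map_sum, map_smul, sum_apply, smul_apply,
    smul_eq_mul]
  refine Finset.sum_congr rfl fun a _ => Finset.sum_congr rfl fun b _ => ?_
  congr 1
  refine Eq.trans ?_ (congrArg (fun v : Eu r => h.formL v ξ)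
    (Γ.curv_rightAct_sec hπ hη he.isVerticallyCovariant hx hg a b)).symm
  have h2 := h.formL_adE g (adE g⁻¹ (Γ.fieldStrengthE η a b x)) ξ
  rw [adE_adE_inv] at h2
  exact h2

omit [LieGroup (𝓡 r) ∞ G] [IsManifold (𝓡 (n + r)) ∞ P] in
theorem mdifferentiableAt_pab (hπ : IsPrincipalBundle n r G π) (p' : Γ.Components vol t p)
    {z : P} (hz : z ∈ π ⁻¹' Γ.base) (a b : Fin n) (ξ : Eu r) :
    MDifferentiableAt (𝓡 (n + r)) 𝓘(ℝ, ℝ) (fun z => p'.pab a b z ξ) z :=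
  ((p'.smooth_pab a b ξ).contMDiffAt ((Γ.isOpen_preimage hπ).mem_nhds hz)).mdifferentiableAt
    (by simp)

omit [LieGroup (𝓡 r) ∞ G] [IsManifold (𝓡 (n + r)) ∞ P] in
theorem mdifferentiableAt_paj (hπ : IsPrincipalBundle n r G π) (p' : Γ.Components vol t p)
    {z : P} (hz : z ∈ π ⁻¹' Γ.base) (a : Fin n) (j : Fin r) (ξ : Eu r) :
    MDifferentiableAt (𝓡 (n + r)) 𝓘(ℝ, ℝ) (fun z => p'.paj a j z ξ) z :=
  ((p'.smooth_paj a j ξ).contMDiffAt ((Γ.isOpen_preimage hπ).mem_nhds hz)).mdifferentiableAt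
    (by simp)

-- Regularity comes from `p`: on the section the raised curvature is `h.sharp` of `p^{cd}`, whose
-- scalar components are smooth.
include hπ in
theorem mdifferentiableAt_fieldStrengthUpE (hκ : κ.det ≠ 0) (hη : η.IsSmooth)
    (he : Γ.Equations h η p') {x : M} (hx : x ∈ Γ.base) (c d : Fin n) :
    MDifferentiableAt (𝓡 n) 𝓘(ℝ, Eu r) (Γ.fieldStrengthUpE η c d) x := by
  let S : Fin r → Eu r := fun i => h.sharp (t.coord i)
  have hd : MDifferentiableAt (𝓡 n) 𝓘(ℝ, Eu r)
      (fun y => ∑ i, p'.pab c d (Γ.sec y) (t i) • S i) x := by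
    have h1 : ∀ i, MDifferentiableAt (𝓡 n) 𝓘(ℝ, ℝ) (fun y => p'.pab c d (Γ.sec y) (t i)) x :=
      fun i => MDifferentiableAt.comp x (Γ.mdifferentiableAt_pab hπ p' (Γ.sec_mem hx) c d (t i))
        (Γ.mdifferentiableAt_sec hx)
    have h2 := MDifferentiableAt.sum (t := Finset.univ)
      (f := fun i y => p'.pab c d (Γ.sec y) (t i) • S i) fun i _ =>
        (h1 i).smul (mdifferentiableAt_const (I := 𝓡 n) (I' := 𝓘(ℝ, Eu r)) (c := S i) (x := x))
    rwa [show (∑ i, fun y => p'.pab c d (Γ.sec y) (t i) • S i) =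
      fun y => ∑ i, p'.pab c d (Γ.sec y) (t i) • S i from funext fun y => Finset.sum_apply _ _ _]
      at h2
  refine hd.congr_of_eventuallyEq ?_
  filter_upwards [Γ.isOpen_base.mem_nhds hx] with y hy
  have h2 := h.sharp_eq (ℓ := p'.pab c d (Γ.sec y)) (v := Γ.fieldStrengthUpE η c d y) fun ξ => by
    have := Γ.formL_fieldStrengthUpE hπ hκ hη he hy (mem_connectedComponent (x := (1 : G))) c d ξ
    rwa [adE_one, rightAct_one] at this
  have h3 : p'.pab c d (Γ.sec y) = ∑ i, p'.pab c d (Γ.sec y) (t i) • t.coord i := by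
    refine t.ext fun j => ?_
    simp
  rw [← h2]
  refine (congrArg (fun ℓ => (show Eu r from h.sharp ℓ)) h3).trans ?_
  exact (map_sum h.sharp _ _).trans (Finset.sum_congr rfl fun i _ => map_smul h.sharp _ _)

/-- The left-hand side of the Yang–Mills equations. -/
def yangMillsE (η : OneForm n r G P) (a : Fin n) (x : M) : Eu r :=
  ∑ b, (dMap (Γ.fieldStrengthUpE η a b) x (Γ.e b x)
    + ∑ d, Γ.leviCivita a b d x • Γ.fieldStrengthUpE η d b x
    + ∑ d, Γ.leviCivita b b d x • Γ.fieldStrengthUpE η a d x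
    + brE G (Γ.potentialE η b x) (Γ.fieldStrengthUpE η a b x))

-- Taking `ξ = Ad_{g⁻¹} ζ` makes the right side independent of `g`. The coadjoint term becomes the
-- commutator term because `Ad` preserves brackets and `ad` is skew for `h`.
include hπ in
theorem sum_covPab_eq (hκ : κ.det ≠ 0) (hη : η.IsSmooth) (he : Γ.Equations h η p')
    {x : M} (hx : x ∈ Γ.base) {g : G} (hg : g ∈ connectedComponent (1 : G)) (a : Fin n)
    (ξ : Eu r) :
    ∑ b, (Γ.covPab p'.pab a b b (rightAct g (Γ.sec x)) ξ -
        p'.pab a b (rightAct g (Γ.sec x)) (brE G (Γ.compE η b (rightAct g (Γ.sec x))) ξ)) =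
      h.formL (Γ.yangMillsE η a x) (adE g ξ) := by
  have hz := Γ.mem_rightAct hπ (Γ.sec_mem hx) g
  rw [yangMillsE, map_sum, sum_apply]
  refine Finset.sum_congr rfl fun b _ => ?_
  have h1 : dDual (p'.pab a b) (rightAct g (Γ.sec x)) (Γ.lift b (rightAct g (Γ.sec x))) ξ =
      h.formL (dMap (Γ.fieldStrengthUpE η a b) x (Γ.e b x)) (adE g ξ) := by
    refine (Γ.dMap_lift hπ hx (Γ.mdifferentiableAt_pab hπ p' hz a b ξ) b).trans ?_
    refine Eq.trans ?_ (dMap_clm_comp (Γ.mdifferentiableAt_fieldStrengthUpE hπ hκ hη he hx a b)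
      (h.formL.flip (adE g ξ)) (Γ.e b x))
    have : (fun y => p'.pab a b (rightAct g (Γ.sec y)) ξ) =ᶠ[𝓝 x]
        fun y => h.formL.flip (adE g ξ) (Γ.fieldStrengthUpE η a b y) := by
      filter_upwards [Γ.isOpen_base.mem_nhds hx] with y hy
      exact (Γ.formL_fieldStrengthUpE hπ hκ hη he hy hg a b ξ).symm
    exact congrArg (fun L : Eu n →L[ℝ] ℝ => L (Γ.e b x)) this.mfderiv_eq
  have h2 : p'.pab a b (rightAct g (Γ.sec x)) (brE G (Γ.compE η b (rightAct g (Γ.sec x))) ξ) =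
      - h.formL (brE G (Γ.potentialE η b x) (Γ.fieldStrengthUpE η a b x)) (adE g ξ) := by
    refine (Γ.formL_fieldStrengthUpE hπ hκ hη he hx hg a b
      (brE G (Γ.compE η b (rightAct g (Γ.sec x))) ξ)).symm.trans ?_
    rw [adE_brE, Γ.compE_rightAct_sec hπ hη he.isVerticallyCovariant hx hg, adE_adE_inv,
      h.formL_brE, neg_neg]
  have h3 : Γ.covPab p'.pab a b b (rightAct g (Γ.sec x)) ξ =
    dDual (p'.pab a b) (rightAct g (Γ.sec x)) (Γ.lift b (rightAct g (Γ.sec x))) ξ +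
      ∑ d, Γ.leviCivita a b d (π (rightAct g (Γ.sec x))) * p'.pab d b (rightAct g (Γ.sec x)) ξ +
      ∑ d, Γ.leviCivita b b d (π (rightAct g (Γ.sec x))) * p'.pab a d (rightAct g (Γ.sec x)) ξ :=
    rfl
  rw [h3, h1, h2, Γ.proj_rightAct_sec hπ hx]
  simp only [map_add, map_sum, map_smul, add_apply, sum_apply,
    smul_apply, smul_eq_mul, sub_neg_eq_add,
    Γ.formL_fieldStrengthUpE hπ hκ hη he hx hg]

omit [IsManifold (𝓡 (n + r)) ∞ P] in
include hπ in
theorem contMDiff_paj_adE_inv (p' : Γ.Components vol t p) {x : M} (hx : x ∈ Γ.base)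
    (a : Fin n) (j : Fin r) (ζ : Eu r) :
    ContMDiff (𝓡 r) 𝓘(ℝ, ℝ) ∞
      (fun g : G => p'.paj a j (rightAct g (Γ.sec x)) (adE g⁻¹ ζ)) := by
  have h1 : (fun g : G => p'.paj a j (rightAct g (Γ.sec x)) (adE g⁻¹ ζ)) = fun g =>
      ∑ i, (basisE t).equivFunL (adE g⁻¹ ζ) i * p'.paj a j (rightAct g (Γ.sec x)) (t i) :=
    funext fun g => dual_apply_eq_sum t _ _
  rw [h1]
  refine contMDiff_finsetSum fun i _ => ContMDiff.mul ?_ ?_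
  · let L : Eu r →L[ℝ] ℝ :=
      (ContinuousLinearMap.proj (R := ℝ) (φ := fun _ : Fin r => ℝ) i).comp
        (basisE t).equivFunL.toContinuousLinearMap
    exact L.contMDiff.comp (contMDiff_adE_inv_apply ζ)
  · exact fun g => ContMDiffAt.comp g ((p'.smooth_paj a j (t i)).contMDiffAt
      ((Γ.isOpen_preimage hπ).mem_nhds (Γ.mem_rightAct hπ (Γ.sec_mem hx) g)))
      (hπ.contMDiff_orbit (Γ.sec x) g)

-- The twist by `Ad_{g⁻¹}` is chosen so that the product rule yields both the derivative of `p^{aj}`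
-- and its coadjoint term, turning the vertical part of the third equation into a divergence on the
-- group.
omit [IsManifold (𝓡 (n + r)) ∞ P] in
include hπ in
theorem dMap_paj_adE_inv (p' : Γ.Components vol t p) {x : M} (hx : x ∈ Γ.base)
    (a : Fin n) (j : Fin r) (ζ : Eu r) (g : G) (ξ : Eu r) :
    dMap (fun k : G => p'.paj a j (rightAct (g * k) (Γ.sec x)) (adE (g * k)⁻¹ ζ)) 1 ξ =
      dDual (p'.paj a j) (rightAct g (Γ.sec x)) (fundVec (G := G) n ξ (rightAct g (Γ.sec x))) (adE g⁻¹ ζ) -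
        p'.paj a j (rightAct g (Γ.sec x)) (brE G ξ (adE g⁻¹ ζ)) := by
  have hz := Γ.mem_rightAct hπ (Γ.sec_mem hx) g
  have hq : MDifferentiableAt (𝓡 r) 𝓘(ℝ, ℝ)
      (fun k : G => p'.paj a j (rightAct (g * k) (Γ.sec x)) (adE (g * k)⁻¹ ζ)) 1 :=
    MDifferentiableAt.comp (1 : G)
      ((Γ.contMDiff_paj_adE_inv hπ p' hx a j ζ).mdifferentiable (by simp) _)
      (mdifferentiable_mul_left g 1)
  have hv : MDifferentiableAt (𝓡 r) 𝓘(ℝ, Eu r) (fun k : G => adE (g * k)⁻¹ ζ) 1 :=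
    MDifferentiableAt.comp (1 : G) ((contMDiff_adE_inv_apply ζ).mdifferentiable (by simp) _)
      (mdifferentiable_mul_left g 1)
  have hℓ : ∀ v : Eu r, HasDerivAt
      (fun s => p'.paj a j (rightAct (g * chartLine (1 : G) ξ s) (Γ.sec x)) v)
      (dDual (p'.paj a j) (rightAct g (Γ.sec x)) (fundVec (G := G) n ξ (rightAct g (Γ.sec x))) v) 0 := by
    intro v
    have hd := Γ.mdifferentiableAt_paj hπ p' hz a j v
    have h1 := hπ.dMap_fundVec hd ξ
    have hd' : MDifferentiableAt (𝓡 r) 𝓘(ℝ, ℝ)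
        (fun k : G => p'.paj a j (rightAct k (rightAct g (Γ.sec x))) v) 1 := by
      refine MDifferentiableAt.comp (1 : G) (g := fun z => p'.paj a j z v) ?_
        (hπ.mdifferentiable_orbit _ 1)
      rwa [rightAct_one]
    have h2 := hasDerivAt_comp_chartLine hd' ξ
    simp only [rightAct_rightAct] at h1 h2
    exact h2.congr_deriv h1.symm
  have h3 := hasDerivAt_dual_apply t hℓ (hasDerivAt_comp_chartLine hv ξ)
  rw [dMap_adE_inv_mul_left, chartLine_zero, mul_one] at h3
  refine (hasDerivAt_comp_chartLine hq ξ).unique (h3.congr_deriv ?_)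
  rw [sub_eq_add_neg]
  exact congrArg _ (map_neg (p'.paj a j (rightAct g (Γ.sec x))) _)

include hπ in
theorem Equations.yangMills [CompactSpace G] (hG : IsUnimodular r G) (hκ : κ.det ≠ 0)
    (hη : η.IsSmooth) (he : Γ.Equations h η p') : Γ.YangMills η := by
  intro x hx a
  -- The third equation makes the divergence equal to minus the Yang–Mills pairing, so the constant
  -- to annihilate is the negative.
  refine h.eq_zero_of_formL (v := Γ.yangMillsE η a x) fun ζ => neg_eq_zero.1 ?_
  refine eq_zero_of_divergence_eq (G := G)
    (q := fun j g => p'.paj a j (rightAct g (Γ.sec x)) (adE g⁻¹ ζ))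
    (fun j => Γ.contMDiff_paj_adE_inv hπ p' hx a j ζ) (fun j => t j) fun g hg => ?_
  have h1 := he.third _ (Γ.mem_rightAct hπ (Γ.sec_mem hx) g) a (adE g⁻¹ ζ)
  have h2 := Γ.sum_covPab_eq hπ hκ hη he hx hg a (adE g⁻¹ ζ)
  rw [adE_adE_inv] at h2
  refine Eq.trans ?_ (neg_eq_iff_eq_neg.2 (h2.symm.trans (eq_neg_of_add_eq_zero_left h1))).symm
  refine Finset.sum_congr rfl fun j _ => ?_
  -- Unimodularity removes the trace term, which is not part of the divergence.
  rw [hG (t j), zero_mul, sub_zero]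
  exact Γ.dMap_paj_adE_inv hπ p' hx a j ζ g (t j)

end LocalGauge

end HVDW

end

theorem mainTheorem1 {n r : ℕ}
    {M : Type*} [TopologicalSpace M] [ChartedSpace (HVDW.Eu n) M] [IsManifold (𝓡 n) ∞ M]
    {G : Type*} [TopologicalSpace G] [ChartedSpace (HVDW.Eu r) G] [Group G]
    [LieGroup (𝓡 r) ∞ G] [CompactSpace G]
    {P : Type*} [TopologicalSpace P] [ChartedSpace (HVDW.Eu (n + r)) P]
    [IsManifold (𝓡 (n + r)) ∞ P] [MulAction Gᵐᵒᵖ P]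
    (π : P → M) (hπ : HVDW.IsPrincipalBundle n r G π)
    (met : HVDW.PseudoRiemannianMetric n M) (h : HVDW.AdInvariantMetric r G)
    (hG : HVDW.IsUnimodular r G)
    (t : Module.Basis (Fin r) ℝ (HVDW.LieAlg r G)) (κ : Matrix (Fin n) (Fin n) ℝ)
    (hκ : κ.IsSymm ∧ κ.det ≠ 0)
    (k : ℕ) (hk : k + 2 = n + r) (𝒜 : HVDW.GaugeAtlas n r G π met κ t k hk)
    (η : HVDW.OneForm n r G P) (hη : η.IsSmooth) (hηn : η.IsNormalized)
    (p : HVDW.DualForm n r G P k) (hsol : 𝒜.IsHVDWSolution h η p) :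
    (∀ g ∈ connectedComponent (1 : G), η.EquivariantUnder g) ∧
      (ConnectedSpace G → η.IsEquivariant) ∧
      𝒜.IsYangMills η := by
  have hv : ∀ Γ ∈ 𝒜.gauges, Γ.IsVerticallyCovariant η := fun Γ hΓ => by
    obtain ⟨_, he⟩ := hsol Γ hΓ
    exact he.isVerticallyCovariant
  have heq : ∀ g ∈ connectedComponent (1 : G), η.EquivariantUnder g := fun g hg =>
    𝒜.equivariantUnder hπ hη hηn hv hg
  refine ⟨heq, fun _ g => heq g ?_, fun Γ hΓ => ?_⟩
  · rw [PreconnectedSpace.connectedComponent_eq_univ]; trivial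
  · obtain ⟨_, he⟩ := hsol Γ hΓ
    exact he.yangMills Γ hπ hG hκ.2 hη
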